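/- Let $M$ be a smooth $n$-dimensional manifold and let $(g,K)$ be a statistical structure on $M$: $g$ is a smooth Riemannian metric with Levi-Civita connection $\hat\nabla$, and $K$ is a smooth $(1,2)$-tensor field such that $K(X,Y)=K(Y,X)$ and $g(K(X,Y),Z)=g(Y,K(X,Z))$ for all $X,Y,Z$. Write $K_XY=K(X,Y)$, and let $\tau(X)=\operatorname{tr}K_X$ be its Czebyshev form. Let $\hat R(X,Y)Z=\hat\nabla_X\hat\nabla_YZ-\hat\nabla_Y\hat\nabla_XZ-\hat\nabla_{[X,Y]}Z$ and $\widehat{\mathrm{Ric}}(Y,Z)=\operatorname{tr}\{X\mapsto\hat R(X,Y)Z\}$ be the curvature and Ricci tensors of $g$, and put $[K,K](X,Y)Z=K_XK_YZ-K_YK_XZ$. The sectional $K$-curvature of a plane $\pi\subset T_xM$ is $g([K,K](e_1,e_2)e_2,e_1)$ for any orthonormal basis $e_1,e_2$ of $\pi$. Assume that the structure is conjugate symmetric, i.e. the tensor field $\hat\nabla K$ is symmetric in all its arguments, that $\hat\nabla\tau=0$, and that $\widehat{\mathrm{Ric}}\ge 0$ on $M$ (that is, $\widehat{\mathrm{Ric}}(X,X)\ge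 0$ for every $X$). Let $\kappa\le 0$ be a real constant such that the sectional $K$-curvature of every tangent plane at every point of $M$ equals $\kappa$. Then $\hat\nabla K=0$. If moreover $\kappa<0$, then also $\widehat{\mathrm{Ric}}=0$ on $M$. -/

import Mathlib

open scoped Manifold ContDiff Bundle Topology
open Bundle

set_option linter.unusedSectionVars false

namespace StatGeom

noncomputable section

variable {E : Type*} [NormedAddCommGroup E] [NormedSpace ℝ E] [FiniteDimensional ℝ E]
  {H : Type*} [TopologicalSpace H] {I : ModelWithCorners ℝ E H}
  {M : Type*} [TopologicalSpace M] [ChartedSpace H M] [IsManifold I ∞ M]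

/-- A field of bilinear maps `K_x : T_xM × T_xM → T_xM`, i.e. a `(1,2)`-tensor field. -/
abbrev Tensor12 (I : ModelWithCorners ℝ E H) (M : Type*) [TopologicalSpace M]
    [ChartedSpace H M] [IsManifold I ∞ M] :=
  ∀ x : M, TangentSpace I x →L[ℝ] TangentSpace I x →L[ℝ] TangentSpace I x

/-- A smooth affine connection on `M` is the Levi-Civita connection of the metric `g` if it is
torsion-free and satisfies `v (g (Y, Z)) = g (∇_v Y, Z) + g (Y, ∇_v Z)`.
In Mathlib's notation `D Y x v` is `∇_v Y` at the point `x`, for `v` in `T_xM`. -/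
structure IsLeviCivita (g : ContMDiffRiemannianMetric I ∞ E (TangentSpace I : M → Type _))
    (D : CovariantDerivative I E (TangentSpace I : M → Type _)) : Prop where
  smooth : D.ContMDiffCovariantDerivative ∞
  torsion_eq_zero : D.torsion = 0
  metric : ∀ (x : M) (v : TangentSpace I x) (Y Z : ∀ p : M, TangentSpace I p),
    MDiffAt (T% Y) x → MDiffAt (T% Z) x →
    d% (fun p ↦ g.inner p (Y p) (Z p)) x v
      = g.inner x (D Y x v) (Z x) + g.inner x (Y x) (D Z x v)

variable (I M) in
/-- A statistical structure given as a pair `(g, K)`: a smooth Riemannian metric `g` and a smooth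
`(1,2)`-tensor field `K` (the difference tensor) which is symmetric and symmetric relative to `g`;
the cubic form is `A (X, Y, Z) = g (K (X, Y), Z)`. -/
structure StatisticalStructure where
  g : ContMDiffRiemannianMetric I ∞ E (TangentSpace I : M → Type _)
  K : Tensor12 I M
  smooth_K : ContMDiff I (I.prod 𝓘(ℝ, E →L[ℝ] E →L[ℝ] E)) ∞
    (fun x ↦ TotalSpace.mk' (E →L[ℝ] E →L[ℝ] E)
      (E := fun x : M ↦ TangentSpace I x →L[ℝ] TangentSpace I x →L[ℝ] TangentSpace I x) x (K x))
  symm : ∀ (x : M) (u v : TangentSpace I x), K x u v = K x v u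
  symm_g : ∀ (x : M) (u v w : TangentSpace I x),
    g.inner x (K x u v) w = g.inner x v (K x u w)

/-- The local extension of a tangent vector `w` agrees near `x` with a global smooth field. -/
lemma exists_global_eventuallyEq_extend [T2Space M] {x : M} (w : TangentSpace I x) :
    ∃ W : ∀ p : M, TangentSpace I p, CMDiff ∞ (T% W) ∧
      ∀ᶠ p in 𝓝 x, W p = FiberBundle.extend E w p := by
  obtain ⟨s, hs, hW⟩ := FiberBundle.exists_contMDiffOn_extend (k := ∞) I E
    (V := (TangentSpace I : M → Type _)) w
  obtain ⟨u, hus, hu, hxu⟩ := mem_nhds_iff.1 hs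
  obtain ⟨φ, -, hφ⟩ := (SmoothBumpFunction.nhds_basis_tsupport (I := I) x).mem_iff.1
    (hu.mem_nhds hxu)
  refine ⟨(φ : M → ℝ) • FiberBundle.extend E w, ?_, ?_⟩
  · exact ContMDiffOn.smul_section_of_tsupport φ.contMDiff.contMDiffOn hu hφ (hW.mono hus)
  · filter_upwards [φ.eventuallyEq_one] with p hp
    simp [hp]

lemma mdiffAt_nabla_extend [T2Space M]
    (D : CovariantDerivative I E (TangentSpace I : M → Type _))
    (hD : D.ContMDiffCovariantDerivative ∞) {x : M} (w : TangentSpace I x)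
    {X : ∀ p : M, TangentSpace I p} (hX : MDiffAt (T% X) x) :
    MDiffAt (T% (fun p ↦ D (FiberBundle.extend E w) p (X p))) x := by
  obtain ⟨W, hW, hWw⟩ := exists_global_eventuallyEq_extend w
  have h := hD.contMDiff.contMDiff (σ := W) (by simpa using hW.contMDiffOn)
  have h1 := MDifferentiableAt.clm_bundle_apply (F₁ := E) (F₂ := E)
    (E₁ := (TangentSpace I : M → Type _)) (E₂ := (TangentSpace I : M → Type _))
    ((h.contMDiffAt Filter.univ_mem).mdifferentiableAt (by simp)) hX
  refine h1.congr_of_eventuallyEq ?_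
  obtain ⟨s, hs, hw⟩ := FiberBundle.exists_mdifferentiableOn_extend I E
    (V := (TangentSpace I : M → Type _)) w
  filter_upwards [hWw.eventually_nhds, eventually_mem_nhds_iff.2 hs] with p hp hps
  have := D.isCovariantDerivativeOn (s := Set.univ) |>.congr_of_eventuallyEq
    (hW.mdifferentiable (by simp) p) (hw.mdifferentiableAt hps) Filter.univ_mem hp
  rw [this]

/-- `R(X, Y) Z = ∇_X ∇_Y Z - ∇_Y ∇_X Z - ∇_[X, Y] Z` at the point `x`. -/
def curvatureAux (D : CovariantDerivative I E (TangentSpace I : M → Type _)) (x : M)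
    (X Y Z : ∀ p : M, TangentSpace I p) : TangentSpace I x :=
  D (fun p ↦ D Z p (Y p)) x (X x) - D (fun p ↦ D Z p (X p)) x (Y x)
    - D Z x (VectorField.mlieBracket I X Y x)

lemma curvatureAux_tensorial_left [T2Space M]
    (D : CovariantDerivative I E (TangentSpace I : M → Type _))
    (hD : D.ContMDiffCovariantDerivative ∞) (x : M) (w : TangentSpace I x)
    (Y : ∀ p : M, TangentSpace I p) :
    TensorialAt I E (curvatureAux D x · Y (FiberBundle.extend E w)) x where
  smul {f X} hf hX := by
    have h : (fun p ↦ D (FiberBundle.extend E w) p ((f • X) p))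
        = f • (fun p ↦ D (FiberBundle.extend E w) p (X p)) := by ext p; simp
    simp only [curvatureAux, h,
      D.isCovariantDerivativeOn.leibniz (mdiffAt_nabla_extend D hD w hX) hf,
      VectorField.mlieBracket_smul_left hf hX]
    simp
    module
  add {X X'} hX hX' := by
    have h : (fun p ↦ D (FiberBundle.extend E w) p ((X + X') p))
        = (fun p ↦ D (FiberBundle.extend E w) p (X p))
          + (fun p ↦ D (FiberBundle.extend E w) p (X' p)) := by ext p; simp
    simp only [curvatureAux, h, D.isCovariantDerivativeOn.add (mdiffAt_nabla_extend D hD w hX)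
      (mdiffAt_nabla_extend D hD w hX'), VectorField.mlieBracket_add_left hX hX']
    simp
    module

lemma curvatureAux_tensorial_right [T2Space M]
    (D : CovariantDerivative I E (TangentSpace I : M → Type _))
    (hD : D.ContMDiffCovariantDerivative ∞) (x : M) (w : TangentSpace I x)
    (X : ∀ p : M, TangentSpace I p) :
    TensorialAt I E (curvatureAux D x X · (FiberBundle.extend E w)) x where
  smul {f Y} hf hY := by
    have h : (fun p ↦ D (FiberBundle.extend E w) p ((f • Y) p))
        = f • (fun p ↦ D (FiberBundle.extend E w) p (Y p)) := by ext p; simp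
    simp only [curvatureAux, h,
      D.isCovariantDerivativeOn.leibniz (mdiffAt_nabla_extend D hD w hY) hf,
      VectorField.mlieBracket_smul_right hf hY]
    simp
    module
  add {Y Y'} hY hY' := by
    have h : (fun p ↦ D (FiberBundle.extend E w) p ((Y + Y') p))
        = (fun p ↦ D (FiberBundle.extend E w) p (Y p))
          + (fun p ↦ D (FiberBundle.extend E w) p (Y' p)) := by ext p; simp
    simp only [curvatureAux, h, D.isCovariantDerivativeOn.add (mdiffAt_nabla_extend D hD w hY)
      (mdiffAt_nabla_extend D hD w hY'), VectorField.mlieBracket_add_right hY hY']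
    simp
    module

/-- The curvature tensor of a smooth connection, with `curvature D hD x w u v = R(u, v) w`.
The tangent vectors are extended to vector fields that are smooth near `x`; the value does not
depend on the extensions. -/
def curvature [T2Space M] (D : CovariantDerivative I E (TangentSpace I : M → Type _))
    (hD : D.ContMDiffCovariantDerivative ∞) (x : M) (w : TangentSpace I x) :
    TangentSpace I x →L[ℝ] TangentSpace I x →L[ℝ] TangentSpace I x :=
  TensorialAt.mkHom₂ (fun X Y ↦ curvatureAux D x X Y (FiberBundle.extend E w)) x
    (fun Y _ ↦ curvatureAux_tensorial_left D hD x w Y)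
    (fun X _ ↦ curvatureAux_tensorial_right D hD x w X)

/-- The Ricci tensor `Ric (v, w) = tr {u ↦ R(u, v) w}`. -/
def ricci [T2Space M] (D : CovariantDerivative I E (TangentSpace I : M → Type _))
    (hD : D.ContMDiffCovariantDerivative ∞) (x : M) (v w : TangentSpace I x) : ℝ :=
  LinearMap.trace ℝ (TangentSpace I x)
    { toFun := fun u ↦ curvature D hD x w u v
      map_add' := by simp
      map_smul' := by simp }

namespace StatisticalStructure

variable (S : StatisticalStructure I M)
  (D : CovariantDerivative I E (TangentSpace I : M → Type _))

lemma mdiffAt_K {x : M} {Y Z : ∀ p : M, TangentSpace I p}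
    (hY : MDiffAt (T% Y) x) (hZ : MDiffAt (T% Z) x) :
    MDiffAt (T% (fun p ↦ S.K p (Y p) (Z p))) x :=
  MDifferentiableAt.clm_bundle_apply₂ (F₁ := E) (F₂ := E) (F₃ := E)
    ((S.smooth_K x).mdifferentiableAt (by simp)) hY hZ

/-- `(∇_v K)(Y, Z) = ∇_v (K (Y, Z)) - K (∇_v Y, Z) - K (Y, ∇_v Z)` at the point `x`. -/
def nablaKAux (x : M) (v : TangentSpace I x) (Y Z : ∀ p : M, TangentSpace I p) :
    TangentSpace I x :=
  D (fun p ↦ S.K p (Y p) (Z p)) x v - S.K x (D Y x v) (Z x) - S.K x (Y x) (D Z x v)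

lemma nablaKAux_tensorial_left (x : M) (v : TangentSpace I x) (Z : ∀ p : M, TangentSpace I p)
    (hZ : MDiffAt (T% Z) x) : TensorialAt I E (S.nablaKAux D x v · Z) x where
  smul {f Y} hf hY := by
    have h : (fun p ↦ S.K p ((f • Y) p) (Z p)) = f • (fun p ↦ S.K p (Y p) (Z p)) := by
      ext p; simp
    simp only [nablaKAux, h, D.isCovariantDerivativeOn.leibniz (S.mdiffAt_K hY hZ) hf,
      D.isCovariantDerivativeOn.leibniz hY hf]
    simp
    module
  add {Y Y'} hY hY' := by
    have h : (fun p ↦ S.K p ((Y + Y') p) (Z p))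
        = (fun p ↦ S.K p (Y p) (Z p)) + (fun p ↦ S.K p (Y' p) (Z p)) := by
      ext p; simp
    simp only [nablaKAux, h, D.isCovariantDerivativeOn.add (S.mdiffAt_K hY hZ) (S.mdiffAt_K hY' hZ),
      D.isCovariantDerivativeOn.add hY hY']
    simp
    module

lemma nablaKAux_tensorial_right (x : M) (v : TangentSpace I x) (Y : ∀ p : M, TangentSpace I p)
    (hY : MDiffAt (T% Y) x) : TensorialAt I E (S.nablaKAux D x v Y ·) x where
  smul {f Z} hf hZ := by
    have h : (fun p ↦ S.K p (Y p) ((f • Z) p)) = f • (fun p ↦ S.K p (Y p) (Z p)) := by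
      ext p; simp
    simp only [nablaKAux, h, D.isCovariantDerivativeOn.leibniz (S.mdiffAt_K hY hZ) hf,
      D.isCovariantDerivativeOn.leibniz hZ hf]
    simp
    module
  add {Z Z'} hZ hZ' := by
    have h : (fun p ↦ S.K p (Y p) ((Z + Z') p))
        = (fun p ↦ S.K p (Y p) (Z p)) + (fun p ↦ S.K p (Y p) (Z' p)) := by
      ext p; simp
    simp only [nablaKAux, h, D.isCovariantDerivativeOn.add (S.mdiffAt_K hY hZ) (S.mdiffAt_K hY hZ'),
      D.isCovariantDerivativeOn.add hZ hZ']
    simp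
    module

/-- The covariant derivative of `K`: `S.nablaK D x v y z = (∇_v K)(y, z)`. -/
def nablaK (x : M) (v : TangentSpace I x) :
    TangentSpace I x →L[ℝ] TangentSpace I x →L[ℝ] TangentSpace I x :=
  TensorialAt.mkHom₂ (S.nablaKAux D x v) x
    (S.nablaKAux_tensorial_left D x v) (S.nablaKAux_tensorial_right D x v)

lemma nablaK_apply {x : M} (v : TangentSpace I x) {Y Z : ∀ p : M, TangentSpace I p}
    (hY : MDiffAt (T% Y) x) (hZ : MDiffAt (T% Z) x) :
    S.nablaK D x v (Y x) (Z x)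
      = D (fun p ↦ S.K p (Y p) (Z p)) x v - S.K x (D Y x v) (Z x) - S.K x (Y x) (D Z x v) :=
  TensorialAt.mkHom₂_apply (S.nablaKAux_tensorial_left D x v) (S.nablaKAux_tensorial_right D x v)
    hY hZ

/-- The Czebyshev form `τ (v) = tr K_v`, where `K_v = K (v, ·)`. -/
def czebyshev (x : M) (v : TangentSpace I x) : ℝ :=
  LinearMap.trace ℝ (TangentSpace I x) (S.K x v).toLinearMap

lemma mdiffAt_czebyshev {x : M} {Y : ∀ p : M, TangentSpace I p} (hY : MDiffAt (T% Y) x) :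
    MDiffAt (fun p ↦ S.czebyshev p (Y p)) x := by
  have h := MDifferentiableAt.clm_bundle_apply (F₁ := E) (F₂ := E →L[ℝ] E)
    (E₁ := fun x : M ↦ TangentSpace I x)
    (E₂ := fun x : M ↦ TangentSpace I x →L[ℝ] TangentSpace I x)
    ((S.smooth_K x).mdifferentiableAt (by simp)) hY
  rw [mdifferentiableAt_hom_bundle] at h
  let tr : (E →L[ℝ] E) →L[ℝ] ℝ := LinearMap.toContinuousLinearMap
    ((LinearMap.trace ℝ E).comp (ContinuousLinearMap.coeLM ℝ))
  have h2 := tr.mdifferentiableAt.comp x h.2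
  refine h2.congr_of_eventuallyEq ?_
  filter_upwards [(trivializationAt E (TangentSpace I : M → Type _) x).open_baseSet.mem_nhds
    (FiberBundle.mem_baseSet_trivializationAt' x)] with p hp
  have h3 := ContinuousLinearMap.inCoordinates_eq (ϕ := S.K p (Y p)) hp hp
  simp only [czebyshev, Function.comp_apply, tr]
  rw [h3]
  exact (LinearMap.trace_conj' (S.K p (Y p)).toLinearMap
    ((trivializationAt E (TangentSpace I : M → Type _) x).continuousLinearEquivAt ℝ p
      hp).toLinearEquiv).symm

/-- `(∇_v τ)(Y) = v (τ (Y)) - τ (∇_v Y)` at the point `x`. -/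
def nablaTauAux (x : M) (v : TangentSpace I x) (Y : ∀ p : M, TangentSpace I p) : ℝ :=
  d% (fun p ↦ S.czebyshev p (Y p)) x v - S.czebyshev x (D Y x v)

lemma nablaTauAux_tensorial (x : M) (v : TangentSpace I x) :
    TensorialAt I E (S.nablaTauAux D x v) x where
  smul {f Y} hf hY := by
    have h : (fun p ↦ S.czebyshev p ((f • Y) p)) = fun p ↦ f p * S.czebyshev p (Y p) := by
      ext p; simp [czebyshev]
    simp only [nablaTauAux, h, mvfderiv_fun_mul hf (S.mdiffAt_czebyshev hY),
      D.isCovariantDerivativeOn.leibniz hY hf]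
    simp [czebyshev]
    ring
  add {Y Y'} hY hY' := by
    have h : (fun p ↦ S.czebyshev p ((Y + Y') p))
        = fun p ↦ S.czebyshev p (Y p) + S.czebyshev p (Y' p) := by
      ext p; simp [czebyshev]
    simp only [nablaTauAux, h, mvfderiv_fun_add (S.mdiffAt_czebyshev hY) (S.mdiffAt_czebyshev hY'),
      D.isCovariantDerivativeOn.add hY hY']
    simp [czebyshev]
    ring

/-- The covariant derivative of the Czebyshev form: `S.nablaTau D x v y = (∇_v τ)(y)`. -/
def nablaTau (x : M) (v : TangentSpace I x) : TangentSpace I x →L[ℝ] ℝ :=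
  TensorialAt.mkHom (S.nablaTauAux D x v) x (S.nablaTauAux_tensorial D x v)

lemma nablaTau_apply {x : M} (v : TangentSpace I x) {Y : ∀ p : M, TangentSpace I p}
    (hY : MDiffAt (T% Y) x) :
    S.nablaTau D x v (Y x) = d% (fun p ↦ S.czebyshev p (Y p)) x v - S.czebyshev x (D Y x v) :=
  TensorialAt.mkHom_apply (S.nablaTauAux_tensorial D x v) hY

/-- A statistical structure is conjugate symmetric if `∇K` is symmetric in all its arguments,
for `∇` the Levi-Civita connection. -/
def IsConjugateSymmetric : Prop :=
  ∀ (x : M) (u v w : TangentSpace I x),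
    S.nablaK D x u v w = S.nablaK D x v u w ∧ S.nablaK D x u v w = S.nablaK D x u w v

/-- The curvature tensor `[K, K](u, v) w = K_u K_v w - K_v K_u w`. -/
def bracketK (x : M) (u v w : TangentSpace I x) : TangentSpace I x :=
  S.K x u (S.K x v w) - S.K x v (S.K x u w)

/-- The sectional `K`-curvature of every tangent plane at every point equals `κ`, where the plane
with orthonormal basis `e₁, e₂` has sectional `K`-curvature `g ([K, K](e₁, e₂) e₂, e₁)`. -/
def HasConstantSectionalKCurvature (κ : ℝ) : Prop :=
  ∀ (x : M) (e₁ e₂ : TangentSpace I x),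
    S.g.inner x e₁ e₁ = 1 → S.g.inner x e₂ e₂ = 1 → S.g.inner x e₁ e₂ = 0 →
    S.g.inner x (S.bracketK x e₁ e₂ e₂) e₁ = κ

end StatisticalStructure

end
end StatGeom

namespace StatGeom

noncomputable section

variable {E : Type*} [NormedAddCommGroup E] [NormedSpace ℝ E] [FiniteDimensional ℝ E]
  {H : Type*} [TopologicalSpace H] {I : ModelWithCorners ℝ E H}
  {M : Type*} [TopologicalSpace M] [ChartedSpace H M] [IsManifold I ∞ M]

/-! ### Smooth vector fields -/

/-! The proof is a pointwise Bochner argument. In an orthonormal basis at any point, |∇K|² + ∑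
Ric(K(e_j, e_k), K(e_j, e_k)) - 2κ scal = 0 (`bochner_formula`). With Ric ≥ 0 and κ ≤ 0 all three
contributions are nonnegative, so each vanishes. This gives ∇K = 0, and for κ < 0 also scal = 0,
which together with Ric ≥ 0 forces Ric = 0. Nothing global enters.

Polarization turns constancy of the sectional K-curvature into a Gauss-type equation quadratic in K
(`inner_K_K`). Its right-hand side is built from the parallel metric, so it drops out on
differentiation. Differentiate twice (`inner_hessK_K`) and contract: since ∇τ = 0, both ∇K and ∇²K
are trace-free (`trace_nablaK`, `sum_coord_hessK`), and what survives is |∇K|² = -⟨ΔK, K⟩.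

Total symmetry of ∇K allows the index of the second derivative in ΔK to be exchanged with an index
of K. The Ricci identity (`hessK_sub_hessK`) then commutes the derivatives, and the commuted term is
again a trace, hence zero. So ΔK consists of curvature terms only. Paired with K, one of them is the
Ricci term; the other two are evaluated by the Gauss-type equation and contribute κ scal each
(`bochner_components`). -/

lemma mdiffAt_of_contMDiff {X : ∀ p : M, TangentSpace I p} (hX : CMDiff ∞ (T% X)) (x : M) :
    MDiffAt (T% X) x :=
  hX.mdifferentiable (by simp) x

lemma contMDiff_nabla {D : CovariantDerivative I E (TangentSpace I : M → Type _)}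
    (hD : D.ContMDiffCovariantDerivative ∞) {X Y : ∀ p : M, TangentSpace I p}
    (hX : CMDiff ∞ (T% X)) (hY : CMDiff ∞ (T% Y)) :
    CMDiff ∞ (T% (fun p ↦ D Y p (X p))) := by
  have h := hD.contMDiff.contMDiff (σ := Y) (by simpa using hY.contMDiffOn)
  exact ContMDiff.clm_bundle_apply (F₁ := E) (F₂ := E)
    (E₁ := (TangentSpace I : M → Type _)) (E₂ := (TangentSpace I : M → Type _))
    (contMDiffOn_univ.1 h) hX

lemma StatisticalStructure.contMDiff_K (S : StatisticalStructure I M)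
    {X Y : ∀ p : M, TangentSpace I p} (hX : CMDiff ∞ (T% X)) (hY : CMDiff ∞ (T% Y)) :
    CMDiff ∞ (T% (fun p ↦ S.K p (X p) (Y p))) :=
  ContMDiff.clm_bundle_apply₂ (F₁ := E) (F₂ := E) (F₃ := E) S.smooth_K hX hY

lemma contMDiff_inner (g : ContMDiffRiemannianMetric I ∞ E (TangentSpace I : M → Type _))
    {X Y : ∀ p : M, TangentSpace I p} (hX : CMDiff ∞ (T% X)) (hY : CMDiff ∞ (T% Y)) :
    CMDiff ∞ (fun p ↦ g.inner p (X p) (Y p)) := by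
  intro x
  have h : ContMDiffAt I (I.prod 𝓘(ℝ)) ∞ (fun p ↦ TotalSpace.mk' ℝ (E := Bundle.Trivial M ℝ) p
      (g.inner p (X p) (Y p))) x :=
    ContMDiffAt.clm_bundle_apply₂ (F₁ := E) (F₂ := E) (F₃ := ℝ) (g.contMDiff x) (hX x) (hY x)
  simp only [contMDiffAt_totalSpace] at h
  exact h.2

lemma contMDiff_mlieBracket {X Y : ∀ p : M, TangentSpace I p}
    (hX : CMDiff ∞ (T% X)) (hY : CMDiff ∞ (T% Y)) :
    CMDiff ∞ (T% (VectorField.mlieBracket I X Y)) := by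
  have : IsManifold I ((⊤ : ℕ∞) + 1 : ℕ∞ω) M := by simpa
  have : IsManifold I (minSmoothness ℝ 2) M := by
    simpa using IsManifold.of_le (m := 2) (n := ∞) (by norm_cast)
  exact ContDiff.mlieBracket_vectorField (m := ⊤) (n := ⊤) hX hY (by simp)

/-- Since `nablaK` is built point by point from extensions of vectors, smoothness is read off from
its expression on fields. -/
lemma StatisticalStructure.contMDiff_nablaK (S : StatisticalStructure I M)
    {D : CovariantDerivative I E (TangentSpace I : M → Type _)}
    (hD : D.ContMDiffCovariantDerivative ∞) {V X Y : ∀ p : M, TangentSpace I p}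
    (hV : CMDiff ∞ (T% V)) (hX : CMDiff ∞ (T% X)) (hY : CMDiff ∞ (T% Y)) :
    CMDiff ∞ (T% (fun p ↦ S.nablaK D p (V p) (X p) (Y p))) := by
  have h : (fun p ↦ S.nablaK D p (V p) (X p) (Y p)) =
      (fun p ↦ D (fun q ↦ S.K q (X q) (Y q)) p (V p)) - (fun p ↦ S.K p (D X p (V p)) (Y p))
        - fun p ↦ S.K p (X p) (D Y p (V p)) := by
    ext p
    exact S.nablaK_apply D (V p) (mdiffAt_of_contMDiff hX p) (mdiffAt_of_contMDiff hY p)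
  have h2 := ((contMDiff_nabla hD hV (S.contMDiff_K hX hY)).sub_section
    (S.contMDiff_K (contMDiff_nabla hD hV hX) hY)).sub_section
    (S.contMDiff_K hX (contMDiff_nabla hD hV hY))
  rw [← h] at h2
  exact h2

/-! ### Differentiating a trace -/

lemma nabla_sum_smul (D : CovariantDerivative I E (TangentSpace I : M → Type _)) {ι : Type*}
    (s : Finset ι) {x : M} {f : ι → M → ℝ} {X : ι → ∀ p : M, TangentSpace I p}
    (hf : ∀ i, MDiffAt (f i) x) (hX : ∀ i, MDiffAt (T% (X i)) x) (v : TangentSpace I x) :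
    D (fun p ↦ ∑ i ∈ s, f i p • X i p) x v
      = ∑ i ∈ s, (f i x • D (X i) x v + d% (f i) x v • X i x) := by
  classical
  induction s using Finset.induction_on with
  | empty =>
    simp only [Finset.sum_empty]
    exact congr($(congrFun D.zero x) v)
  | insert i s hi ih =>
    have h1 : (fun p ↦ ∑ j ∈ insert i s, f j p • X j p)
        = f i • X i + fun p ↦ ∑ j ∈ s, f j p • X j p := by
      ext p; simp [Finset.sum_insert hi]
    have h2 : MDiffAt (T% (fun p ↦ ∑ j ∈ s, f j p • X j p)) x :=
      MDifferentiableAt.sum_section (t := fun j ↦ f j • X j)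
        fun j _ ↦ (hf j).smul_section (hX j)
    rw [h1, D.isCovariantDerivativeOn.add ((hf i).smul_section (hX i)) h2,
      D.isCovariantDerivativeOn.leibniz (hX i) (hf i), Finset.sum_insert hi, ← ih]
    simp

lemma mvfderiv_sum {ι : Type*} (s : Finset ι) {x : M} {f : ι → M → ℝ}
    (hf : ∀ i, MDiffAt (f i) x) (v : TangentSpace I x) :
    d% (fun p ↦ ∑ i ∈ s, f i p) x v = ∑ i ∈ s, d% (f i) x v := by
  classical
  induction s using Finset.induction_on with
  | empty => simp [mvfderiv_const]
  | insert i s hi ih =>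
    have h2 : MDiffAt (fun p ↦ ∑ j ∈ s, f j p) x := by
      clear ih hi
      induction s using Finset.induction_on with
      | empty => simpa using mdifferentiableAt_const
      | insert j s hj ih => simp only [Finset.sum_insert hj]; exact (hf j).add ih
    simp only [Finset.sum_insert hi]
    rw [mvfderiv_fun_add (hf i) h2, ← ih]
    rfl

lemma mvfderiv_congr {f f' : M → ℝ} {x : M} (h : f =ᶠ[𝓝 x] f') : d% f x = d% f' x := by
  ext v
  exact congr($(h.mfderiv_eq (I := I)) v)

/-- `v (tr T) = tr (∇_v T)`, the right-hand side being computed with the extensions of a basis. -/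
lemma mvfderiv_trace (D : CovariantDerivative I E (TangentSpace I : M → Type _))
    {ι : Type*} [Fintype ι] {x : M}
    (T : ∀ p : M, TangentSpace I p →L[ℝ] TangentSpace I p)
    (e : Module.Basis ι ℝ (TangentSpace I x)) (F : ι → ∀ p : M, TangentSpace I p)
    (hF : ∀ i, MDiffAt (T% (F i)) x) (hFe : ∀ i, ∀ᶠ p in 𝓝 x, F i p = FiberBundle.extend E (e i) p)
    (hT : ∀ i, MDiffAt (T% (fun p ↦ T p (F i p))) x) (v : TangentSpace I x) :
    d% (fun p ↦ LinearMap.trace ℝ (TangentSpace I p) (T p).toLinearMap) x v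
      = ∑ i, e.coord i (D (fun p ↦ T p (F i p)) x v - T x (D (F i) x v)) := by
  classical
  let t := trivializationAt E (TangentSpace I : M → Type _) x
  have hx : x ∈ t.baseSet := FiberBundle.mem_baseSet_trivializationAt' x
  -- `FiberBundle.extend` is constant in the trivialization at x, so with this basis of the model
  -- space the local frame coincides with the `F i` near x.
  let b : Module.Basis ι ℝ E := e.map (t.linearEquivAt ℝ x hx)
  have hFb : ∀ᶠ p in 𝓝 x, ∀ i, F i p = t.localFrame b i p := by
    rw [Filter.eventually_all]
    intro i
    filter_upwards [hFe i, t.open_baseSet.mem_nhds hx] with p hp hpt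
    rw [hp, t.localFrame_apply_of_mem_baseSet b hpt]
    simp [Bundle.Trivialization.basisAt, b, FiberBundle.extend, t]
  let c : ι → ∀ p : M, TangentSpace I p →ₗ[ℝ] ℝ := fun i ↦ t.localFrameCoeff I b i
  have hc : ∀ i, c i x = e.coord i := by
    intro i
    ext w
    have h := t.localFrameCoeff_eq_coeff (I := I) (b := b) (s := FiberBundle.extend E w) hx (i := i)
    simp only [FiberBundle.extend_apply_self] at h
    simp only [c, h, b, Module.Basis.map_repr, LinearEquiv.trans_apply, Module.Basis.coord_apply]
    congr 2
    rw [LinearEquiv.symm_apply_eq]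
    rfl
  have hFx : ∀ i, F i x = e i := fun i ↦ by
    rw [(hFe i).self_of_nhds]; simp
  have hcd : ∀ i (X : ∀ p : M, TangentSpace I p), MDiffAt (T% X) x →
      MDiffAt (fun p ↦ c i p (X p)) x := fun i X hX ↦
    mdifferentiableAt_localFrameCoeff b hx hX i
  have hexp : ∀ X : ∀ p : M, TangentSpace I p, MDiffAt (T% X) x →
      D X x v = ∑ i, (c i x (X x) • D (F i) x v + d% (fun p ↦ c i p (X p)) x v • F i x) := by
    intro X hX
    rw [← nabla_sum_smul D Finset.univ (fun i ↦ hcd i X hX) hF v]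
    have h2 : MDiffAt (T% (fun p ↦ ∑ j, c j p (X p) • F j p)) x :=
      MDifferentiableAt.sum_section (t := fun j ↦ (fun p ↦ c j p (X p)) • F j)
        fun j _ ↦ (hcd j X hX).smul_section (hF j)
    refine congr($(D.isCovariantDerivativeOn.congr_of_eventuallyEq (s := Set.univ) hX h2
      Filter.univ_mem ?_) v)
    filter_upwards [hFb, t.eventually_eq_localFrame_sum_coeff_smul b hx (s := X) (I := I)]
      with p h1 h2
    rw [h2]
    simp only [h1]
    simp only [← h2, c]
  have htr : (fun p ↦ LinearMap.trace ℝ (TangentSpace I p) (T p).toLinearMap) =ᶠ[𝓝 x]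
      fun p ↦ ∑ i, c i p (T p (F i p)) := by
    filter_upwards [hFb, t.open_baseSet.mem_nhds hx] with p h1 hpt
    rw [LinearMap.trace_eq_matrix_trace ℝ (t.basisAt b hpt)]
    simp only [Matrix.trace, Matrix.diag, LinearMap.toMatrix_apply]
    refine Finset.sum_congr rfl fun i _ ↦ ?_
    rw [h1, t.localFrame_apply_of_mem_baseSet b hpt]
    have h := t.localFrameCoeff_apply_of_mem_baseSet (I := I) b hpt
      (FiberBundle.extend E (T p (t.basisAt b hpt i))) i
    simp only [FiberBundle.extend_apply_self] at h
    exact h.symm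
  have hd : d% (fun p ↦ LinearMap.trace ℝ (TangentSpace I p) (T p).toLinearMap) x v
      = ∑ i, d% (fun p ↦ c i p (T p (F i p))) x v := by
    rw [← mvfderiv_sum Finset.univ (fun i ↦ hcd i _ (hT i)) v]
    rw [mvfderiv_congr htr]
  rw [hd]
  have h3 : ∀ i, e.coord i (D (fun p ↦ T p (F i p)) x v)
      = ∑ j, e.coord j (T x (e i)) * e.coord i (D (F j) x v)
        + d% (fun p ↦ c i p (T p (F i p))) x v := by
    intro i
    rw [hexp _ (hT i)]
    simp [map_sum, Finset.sum_add_distrib, hc, hFx, Finsupp.single_apply]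
  have h4 : ∀ i, e.coord i (T x (D (F i) x v))
      = ∑ j, e.coord j (D (F i) x v) * e.coord i (T x (e j)) := by
    intro i
    conv_lhs => rw [← e.sum_repr (D (F i) x v)]
    simp only [map_sum, map_smul, smul_eq_mul]
    rfl
  simp only [map_sub, h3, h4, Finset.sum_sub_distrib, Finset.sum_add_distrib]
  -- The connection coefficients enter through the commutator of T with the connection matrix, which
  -- has trace zero.
  rw [Finset.sum_comm (f := fun i j ↦ e.coord j (T x (e i)) * e.coord i (D (F j) x v))]
  simp [mul_comm]

/-! ### Identities for the curvature -/

lemma mlieBracket_jacobi {X Y Z : ∀ p : M, TangentSpace I p}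
    (hX : CMDiff ∞ (T% X)) (hY : CMDiff ∞ (T% Y)) (hZ : CMDiff ∞ (T% Z)) (x : M) :
    VectorField.mlieBracket I X (VectorField.mlieBracket I Y Z) x
      = VectorField.mlieBracket I (VectorField.mlieBracket I X Y) Z x
        + VectorField.mlieBracket I Y (VectorField.mlieBracket I X Z) x := by
  have : IsManifold I (minSmoothness ℝ 3) M := by
    simpa using IsManifold.of_le (m := 3) (n := ∞) (by norm_cast)
  have h : minSmoothness ℝ 2 ≤ ∞ := by simp; norm_cast
  exact VectorField.leibniz_identity_mlieBracket_apply
    ((hX x).of_le h) ((hY x).of_le h) ((hZ x).of_le h)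

/-- `X (Y f) - Y (X f) = [X, Y] f`. -/
lemma mvfderiv_commutator [T2Space M] {X Y : ∀ p : M, TangentSpace I p} {f : M → ℝ}
    (hX : CMDiff ∞ (T% X)) (hY : CMDiff ∞ (T% Y)) (hf : CMDiff ∞ f)
    (hXf : CMDiff ∞ (fun p ↦ d% f p (X p))) (hYf : CMDiff ∞ (fun p ↦ d% f p (Y p))) (x : M) :
    d% (fun p ↦ d% f p (Y p)) x (X x) - d% (fun p ↦ d% f p (X p)) x (Y x)
      = d% f x (VectorField.mlieBracket I X Y x) := by
  rcases subsingleton_or_nontrivial (TangentSpace I x) with h | h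
  · rw [Subsingleton.elim (X x) 0, Subsingleton.elim (Y x) 0,
      Subsingleton.elim (VectorField.mlieBracket I X Y x) 0]
    simp
  -- The formula is the coefficient of Z in the Jacobi identity for X, Y and fZ; reading it off
  -- needs a field Z with Z x ≠ 0.
  obtain ⟨z, hz⟩ := exists_ne (0 : TangentSpace I x)
  obtain ⟨Z, hZ, hZz⟩ := exists_global_eventuallyEq_extend z
  have hZx : Z x = z := by rw [hZz.self_of_nhds]; simp
  have dd : ∀ {h : M → ℝ}, CMDiff ∞ h → ∀ p, MDiffAt h p := fun hh p ↦
    hh.mdifferentiable (by simp) p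
  have key : ∀ {A : ∀ p : M, TangentSpace I p}, CMDiff ∞ (T% A) →
      VectorField.mlieBracket I A (f • Z)
        = (fun p ↦ d% f p (A p)) • Z + f • VectorField.mlieBracket I A Z := by
    intro A hA
    ext p
    rw [VectorField.mlieBracket_smul_right (dd hf p) (mdiffAt_of_contMDiff hZ p)]
    rfl
  have key2 : ∀ {A B : ∀ p : M, TangentSpace I p}, CMDiff ∞ (T% A) → CMDiff ∞ (T% B) →
      CMDiff ∞ (fun p ↦ d% f p (B p)) →
      VectorField.mlieBracket I A (VectorField.mlieBracket I B (f • Z)) x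
        = d% (fun p ↦ d% f p (B p)) x (A x) • Z x
          + d% f x (B x) • VectorField.mlieBracket I A Z x
          + (d% f x (A x) • VectorField.mlieBracket I B Z x
            + f x • VectorField.mlieBracket I A (VectorField.mlieBracket I B Z) x) := by
    intro A B hA hB hBf
    have hBZ := contMDiff_mlieBracket hB hZ
    rw [key hB, VectorField.mlieBracket_add_right
      (mdiffAt_of_contMDiff (hBf.smul_section hZ) x) (mdiffAt_of_contMDiff (hf.smul_section hBZ) x),
      VectorField.mlieBracket_smul_right (dd hBf x) (mdiffAt_of_contMDiff hZ x),
      VectorField.mlieBracket_smul_right (dd hf x) (mdiffAt_of_contMDiff hBZ x)]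
  have j1 := mlieBracket_jacobi hX hY (hf.smul_section hZ) x
  have j2 := mlieBracket_jacobi hX hY hZ x
  rw [key2 hX hY hYf, key2 hY hX hXf, key (contMDiff_mlieBracket hX hY)] at j1
  simp only [Pi.add_apply, Pi.smul_apply', j2, hZx] at j1
  have j3 : (d% (fun p ↦ d% f p (Y p)) x (X x) - d% (fun p ↦ d% f p (X p)) x (Y x)
      - d% f x (VectorField.mlieBracket I X Y x)) • z = 0 := by
    rw [← sub_eq_zero] at j1
    rw [← j1]
    module
  have := (smul_eq_zero.1 j3).resolve_right hz
  linarith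

lemma nabla_sub (D : CovariantDerivative I E (TangentSpace I : M → Type _))
    {X Y : ∀ p : M, TangentSpace I p} {x : M} (hX : MDiffAt (T% X) x) (hY : MDiffAt (T% Y) x) :
    D (X - Y) x = D X x - D Y x := by
  have h : X - Y = X + (-1 : ℝ) • Y := by ext; simp [sub_eq_add_neg]
  rw [h, D.isCovariantDerivativeOn.add hX (hY.smul_const_section (a := (-1 : ℝ))),
    D.isCovariantDerivativeOn.smul_const (-1) hY]
  simp [sub_eq_add_neg]

namespace IsLeviCivita

variable {g : ContMDiffRiemannianMetric I ∞ E (TangentSpace I : M → Type _)}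
  {D : CovariantDerivative I E (TangentSpace I : M → Type _)}

lemma torsion_free (hD : IsLeviCivita g D) {X Y : ∀ p : M, TangentSpace I p}
    (hX : CMDiff ∞ (T% X)) (hY : CMDiff ∞ (T% Y)) (x : M) :
    VectorField.mlieBracket I X Y x = D Y x (X x) - D X x (Y x) := by
  have h := D.torsion_apply (mdiffAt_of_contMDiff hX x) (mdiffAt_of_contMDiff hY x)
  rw [hD.torsion_eq_zero] at h
  exact (sub_eq_zero.1 h.symm).symm

lemma mvfderiv_inner (hD : IsLeviCivita g D) {X Y : ∀ p : M, TangentSpace I p}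
    (hX : CMDiff ∞ (T% X)) (hY : CMDiff ∞ (T% Y)) (x : M) (v : TangentSpace I x) :
    d% (fun p ↦ g.inner p (X p) (Y p)) x v
      = g.inner x (D X x v) (Y x) + g.inner x (X x) (D Y x v) :=
  hD.metric x v X Y (mdiffAt_of_contMDiff hX x) (mdiffAt_of_contMDiff hY x)

/-- The curvature operator `R(X, Y)` is skew-symmetric for the metric. -/
lemma inner_curvatureAux_skew [T2Space M] (hD : IsLeviCivita g D)
    {X Y Z W : ∀ p : M, TangentSpace I p}
    (hX : CMDiff ∞ (T% X)) (hY : CMDiff ∞ (T% Y)) (hZ : CMDiff ∞ (T% Z)) (hW : CMDiff ∞ (T% W))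
    (x : M) :
    g.inner x (curvatureAux D x X Y Z) (W x) = - g.inner x (Z x) (curvatureAux D x X Y W) := by
  have key : ∀ {A : ∀ p : M, TangentSpace I p}, CMDiff ∞ (T% A) →
      (fun p ↦ d% (fun q ↦ g.inner q (Z q) (W q)) p (A p))
        = (fun p ↦ g.inner p (D Z p (A p)) (W p)) + fun p ↦ g.inner p (Z p) (D W p (A p)) := by
    intro A hA
    ext p
    exact hD.mvfderiv_inner hZ hW p (A p)
  have sm : ∀ {A : ∀ p : M, TangentSpace I p}, CMDiff ∞ (T% A) →
      CMDiff ∞ (fun p ↦ g.inner p (D Z p (A p)) (W p)) ∧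
        CMDiff ∞ (fun p ↦ g.inner p (Z p) (D W p (A p))) := fun hA ↦
    ⟨contMDiff_inner g (contMDiff_nabla hD.smooth hA hZ) hW,
      contMDiff_inner g hZ (contMDiff_nabla hD.smooth hA hW)⟩
  have h := mvfderiv_commutator hX hY (contMDiff_inner g hZ hW)
    (by rw [key hX]; exact (sm hX).1.add (sm hX).2) (by rw [key hY]; exact (sm hY).1.add (sm hY).2) x
  -- The two middle terms are exchanged by A ↔ B and cancel in the commutator.
  have key2 : ∀ {A B : ∀ p : M, TangentSpace I p}, CMDiff ∞ (T% A) → CMDiff ∞ (T% B) →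
      d% (fun p ↦ d% (fun q ↦ g.inner q (Z q) (W q)) p (B p)) x (A x)
        = g.inner x (D (fun p ↦ D Z p (B p)) x (A x)) (W x)
          + g.inner x (D Z x (B x)) (D W x (A x))
          + (g.inner x (D Z x (A x)) (D W x (B x))
            + g.inner x (Z x) (D (fun p ↦ D W p (B p)) x (A x))) := by
    intro A B hA hB
    rw [key hB, mvfderiv_add ((sm hB).1.mdifferentiable (by simp) x)
      ((sm hB).2.mdifferentiable (by simp) x)]
    rw [add_apply,
      hD.mvfderiv_inner (contMDiff_nabla hD.smooth hB hZ) hW,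
      hD.mvfderiv_inner hZ (contMDiff_nabla hD.smooth hB hW)]
  rw [key2 hX hY, key2 hY hX, hD.mvfderiv_inner hZ hW] at h
  simp only [curvatureAux, map_sub, sub_apply]
  linarith

/-- The first Bianchi identity. -/
lemma curvatureAux_bianchi (hD : IsLeviCivita g D)
    {X Y Z : ∀ p : M, TangentSpace I p}
    (hX : CMDiff ∞ (T% X)) (hY : CMDiff ∞ (T% Y)) (hZ : CMDiff ∞ (T% Z)) (x : M) :
    curvatureAux D x X Y Z + curvatureAux D x Y Z X + curvatureAux D x Z X Y = 0 := by
  have key : ∀ {A B : ∀ p : M, TangentSpace I p}, CMDiff ∞ (T% A) → CMDiff ∞ (T% B) →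
      ∀ v : TangentSpace I x, D (VectorField.mlieBracket I A B) x v
        = D (fun p ↦ D B p (A p)) x v - D (fun p ↦ D A p (B p)) x v := by
    intro A B hA hB v
    have h : VectorField.mlieBracket I A B
        = (fun p ↦ D B p (A p)) - fun p ↦ D A p (B p) := by
      ext p
      exact hD.torsion_free hA hB p
    rw [h, nabla_sub D (mdiffAt_of_contMDiff (contMDiff_nabla hD.smooth hA hB) x)
      (mdiffAt_of_contMDiff (contMDiff_nabla hD.smooth hB hA) x)]
    rfl
  have key2 : ∀ {A B C : ∀ p : M, TangentSpace I p}, CMDiff ∞ (T% A) → CMDiff ∞ (T% B) →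
      CMDiff ∞ (T% C) → VectorField.mlieBracket I A (VectorField.mlieBracket I B C) x
        = D (fun p ↦ D C p (B p)) x (A x) - D (fun p ↦ D B p (C p)) x (A x)
          - D A x (VectorField.mlieBracket I B C x) := by
    intro A B C hA hB hC
    rw [hD.torsion_free hA (contMDiff_mlieBracket hB hC), key hB hC]
  -- Once torsion-freeness has expressed all brackets through ∇, the Jacobi identity is the cyclic
  -- sum of curvatures.
  have j := mlieBracket_jacobi hX hY hZ x
  rw [VectorField.mlieBracket_swap_apply (V := VectorField.mlieBracket I X Y),
    VectorField.mlieBracket_swap (V := X) (W := Z)] at j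
  have hneg : VectorField.mlieBracket I Y (-VectorField.mlieBracket I Z X) x
      = - VectorField.mlieBracket I Y (VectorField.mlieBracket I Z X) x := by
    have := VectorField.mlieBracket_const_smul_right (c := (-1 : ℝ)) (V := Y)
      (mdiffAt_of_contMDiff (contMDiff_mlieBracket hZ hX) x)
    simpa using this
  rw [hneg, key2 hX hY hZ, key2 hZ hX hY, key2 hY hZ hX, ← sub_eq_zero] at j
  rw [← j]
  simp only [curvatureAux]
  abel

end IsLeviCivita

/-- The curvature tensor evaluated on a vector field that locally is the standard extension. -/
lemma curvature_eq_curvatureAux [T2Space M]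
    {D : CovariantDerivative I E (TangentSpace I : M → Type _)}
    (hD : D.ContMDiffCovariantDerivative ∞) {x : M} {w : TangentSpace I x}
    {X Y W : ∀ p : M, TangentSpace I p} (hX : CMDiff ∞ (T% X)) (hY : CMDiff ∞ (T% Y))
    (hW : CMDiff ∞ (T% W)) (hWw : ∀ᶠ p in 𝓝 x, W p = FiberBundle.extend E w p) :
    curvature D hD x w (X x) (Y x) = curvatureAux D x X Y W := by
  have h1 : curvature D hD x w (X x) (Y x)
      = curvatureAux D x X Y (FiberBundle.extend E w) :=
    TensorialAt.mkHom₂_apply _ _ (mdiffAt_of_contMDiff hX x) (mdiffAt_of_contMDiff hY x)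
  rw [h1]
  obtain ⟨s, hs, hw⟩ := FiberBundle.exists_mdifferentiableOn_extend I E
    (V := (TangentSpace I : M → Type _)) w
  -- Curvature differentiates twice, so the first derivatives must agree on a neighbourhood, not
  -- just at x.
  have hD' : ∀ᶠ p in 𝓝 x, D (FiberBundle.extend E w) p = D W p := by
    filter_upwards [hWw.eventually_nhds, eventually_mem_nhds_iff.2 hs] with p hp hps
    exact (D.isCovariantDerivativeOn (s := Set.univ) |>.congr_of_eventuallyEq
      (mdiffAt_of_contMDiff hW p) (hw.mdifferentiableAt hps) Filter.univ_mem hp).symm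
  have h2 : ∀ {A : ∀ p : M, TangentSpace I p}, CMDiff ∞ (T% A) →
      D (fun p ↦ D (FiberBundle.extend E w) p (A p)) x = D (fun p ↦ D W p (A p)) x := by
    intro A hA
    refine D.isCovariantDerivativeOn (s := Set.univ) |>.congr_of_eventuallyEq
      (mdiffAt_nabla_extend D hD w (mdiffAt_of_contMDiff hA x))
      (mdiffAt_of_contMDiff (contMDiff_nabla hD hA hW) x) Filter.univ_mem ?_
    filter_upwards [hD'] with p hp
    rw [hp]
  simp only [curvatureAux, h2 hX, h2 hY, hD'.self_of_nhds]

/-! ### Second covariant derivative of K, Ricci identity and traces -/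

namespace StatisticalStructure

variable (S : StatisticalStructure I M)
  (D : CovariantDerivative I E (TangentSpace I : M → Type _))

/-- The second covariant derivative `(∇²_{W, V} K)(Y, Z)` of `K` at the point `x`. -/
def hessK (x : M) (W V Y Z : ∀ p : M, TangentSpace I p) : TangentSpace I x :=
  D (fun p ↦ S.nablaK D p (V p) (Y p) (Z p)) x (W x) - S.nablaK D x (D V x (W x)) (Y x) (Z x)
    - S.nablaK D x (V x) (D Y x (W x)) (Z x) - S.nablaK D x (V x) (Y x) (D Z x (W x))

variable {S D}

lemma nabla_K {Y Z : ∀ p : M, TangentSpace I p} (hY : CMDiff ∞ (T% Y)) (hZ : CMDiff ∞ (T% Z))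
    (x : M) (v : TangentSpace I x) :
    D (fun p ↦ S.K p (Y p) (Z p)) x v
      = S.nablaK D x v (Y x) (Z x) + S.K x (D Y x v) (Z x) + S.K x (Y x) (D Z x v) := by
  rw [S.nablaK_apply D v (mdiffAt_of_contMDiff hY x) (mdiffAt_of_contMDiff hZ x)]
  abel

lemma nabla_nablaK (W V Y Z : ∀ p : M, TangentSpace I p) (x : M) :
    D (fun p ↦ S.nablaK D p (V p) (Y p) (Z p)) x (W x)
      = S.hessK D x W V Y Z + S.nablaK D x (D V x (W x)) (Y x) (Z x)
        + S.nablaK D x (V x) (D Y x (W x)) (Z x) + S.nablaK D x (V x) (Y x) (D Z x (W x)) := by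
  simp only [hessK]
  abel

/-- Symmetry of ∇K holds at every point and so survives differentiation. Together with
`hessK_swap_right` this makes ∇²K symmetric in its last three arguments; exchanging the first two
costs curvature. -/
lemma IsConjugateSymmetric.hessK_swap_left (h : S.IsConjugateSymmetric D) (x : M)
    (W V Y Z : ∀ p : M, TangentSpace I p) : S.hessK D x W V Y Z = S.hessK D x W Y V Z := by
  have h1 : (fun p ↦ S.nablaK D p (V p) (Y p) (Z p))
      = fun p ↦ S.nablaK D p (Y p) (V p) (Z p) := by
    ext p; exact (h p _ _ _).1
  simp only [hessK, h1]
  rw [(h x (D V x (W x)) _ _).1, (h x (V x) (D Y x (W x)) _).1, (h x (V x) (Y x) _).1]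
  abel

lemma IsConjugateSymmetric.hessK_swap_right (h : S.IsConjugateSymmetric D) (x : M)
    (W V Y Z : ∀ p : M, TangentSpace I p) : S.hessK D x W V Y Z = S.hessK D x W V Z Y := by
  have h1 : (fun p ↦ S.nablaK D p (V p) (Y p) (Z p))
      = fun p ↦ S.nablaK D p (V p) (Z p) (Y p) := by
    ext p; exact (h p _ _ _).2
  simp only [hessK, h1]
  rw [(h x (D V x (W x)) _ _).2, (h x (V x) (D Y x (W x)) _).2, (h x (V x) (Y x) _).2]
  abel

section Metric

variable [T2Space M] (hD : IsLeviCivita S.g D)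

include hD

/-- Differentiate g(K(Y, Z), W) = g(Z, K(Y, W)), using that g is parallel. -/
lemma inner_nablaK (x : M) (v y z w : TangentSpace I x) :
    S.g.inner x (S.nablaK D x v y z) w = S.g.inner x z (S.nablaK D x v y w) := by
  obtain ⟨Y, hY, hYy⟩ := exists_global_eventuallyEq_extend y
  obtain ⟨Z, hZ, hZz⟩ := exists_global_eventuallyEq_extend z
  obtain ⟨W, hW, hWw⟩ := exists_global_eventuallyEq_extend w
  have hy : Y x = y := by rw [hYy.self_of_nhds]; simp
  have hz : Z x = z := by rw [hZz.self_of_nhds]; simp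
  have hw : W x = w := by rw [hWw.self_of_nhds]; simp
  have h1 := hD.mvfderiv_inner (S.contMDiff_K hY hZ) hW x v
  have h2 := hD.mvfderiv_inner hZ (S.contMDiff_K hY hW) x v
  simp only [S.symm_g, nabla_K hY hZ, nabla_K hY hW, map_add, add_apply, hy, hz, hw] at h1 h2
  linarith

lemma inner_hessK {W V Y Z U : ∀ p : M, TangentSpace I p}
    (hV : CMDiff ∞ (T% V)) (hY : CMDiff ∞ (T% Y))
    (hZ : CMDiff ∞ (T% Z)) (hU : CMDiff ∞ (T% U)) (x : M) :
    S.g.inner x (S.hessK D x W V Y Z) (U x) = S.g.inner x (Z x) (S.hessK D x W V Y U) := by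
  have h1 := hD.mvfderiv_inner (S.contMDiff_nablaK hD.smooth hV hY hZ) hU x (W x)
  have h2 := hD.mvfderiv_inner hZ (S.contMDiff_nablaK hD.smooth hV hY hU) x (W x)
  simp only [inner_nablaK hD, nabla_nablaK, map_add, add_apply] at h1 h2
  linarith

/-- The Ricci identity for `K`. -/
lemma hessK_sub_hessK {W V Y Z : ∀ p : M, TangentSpace I p} (hW : CMDiff ∞ (T% W))
    (hV : CMDiff ∞ (T% V)) (hY : CMDiff ∞ (T% Y)) (hZ : CMDiff ∞ (T% Z)) (x : M) :
    S.hessK D x W V Y Z - S.hessK D x V W Y Z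
      = curvatureAux D x W V (fun p ↦ S.K p (Y p) (Z p))
        - S.K x (curvatureAux D x W V Y) (Z x) - S.K x (Y x) (curvatureAux D x W V Z) := by
  -- Apart from iterated derivatives along A and B, the terms either form pairs symmetric under A ↔
  -- B or involve ∇_A B, which antisymmetrizes to the bracket.
  have key : ∀ {A B : ∀ p : M, TangentSpace I p}, CMDiff ∞ (T% A) → CMDiff ∞ (T% B) →
      S.hessK D x A B Y Z = D (fun p ↦ D (fun q ↦ S.K q (Y q) (Z q)) p (B p)) x (A x)
        - (S.nablaK D x (A x) (D Y x (B x)) (Z x) + S.K x (D (fun p ↦ D Y p (B p)) x (A x)) (Z x)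
          + S.K x (D Y x (B x)) (D Z x (A x)))
        - (S.nablaK D x (A x) (Y x) (D Z x (B x)) + S.K x (D Y x (A x)) (D Z x (B x))
          + S.K x (Y x) (D (fun p ↦ D Z p (B p)) x (A x)))
        - (D (fun q ↦ S.K q (Y q) (Z q)) x (D B x (A x))
          - S.K x (D Y x (D B x (A x))) (Z x) - S.K x (Y x) (D Z x (D B x (A x))))
        - S.nablaK D x (B x) (D Y x (A x)) (Z x) - S.nablaK D x (B x) (Y x) (D Z x (A x)) := by
    intro A B hA hB
    have hBY := contMDiff_nabla hD.smooth hB hY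
    have hBZ := contMDiff_nabla hD.smooth hB hZ
    have h : (fun p ↦ S.nablaK D p (B p) (Y p) (Z p)) =
        (fun p ↦ D (fun q ↦ S.K q (Y q) (Z q)) p (B p)) - (fun p ↦ S.K p (D Y p (B p)) (Z p))
          - fun p ↦ S.K p (Y p) (D Z p (B p)) := by
      ext p
      exact S.nablaK_apply D (B p) (mdiffAt_of_contMDiff hY p) (mdiffAt_of_contMDiff hZ p)
    have h1 := contMDiff_nabla hD.smooth hB (S.contMDiff_K hY hZ)
    have h2 := S.contMDiff_K hBY hZ
    have h3 := S.contMDiff_K hY hBZ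
    rw [hessK, h, nabla_sub D (mdiffAt_of_contMDiff (h1.sub_section h2) x)
      (mdiffAt_of_contMDiff h3 x), nabla_sub D (mdiffAt_of_contMDiff h1 x)
      (mdiffAt_of_contMDiff h2 x), sub_apply, sub_apply, nabla_K hBY hZ, nabla_K hY hBZ,
      S.nablaK_apply D (D B x (A x)) (mdiffAt_of_contMDiff hY x) (mdiffAt_of_contMDiff hZ x)]
  rw [key hW hV, key hV hW]
  simp only [curvatureAux, hD.torsion_free hW hV, map_sub, sub_apply]
  abel

end Metric

/-- Traces commute with ∇ (`mvfderiv_trace`); hence ∇τ = 0 makes ∇K trace-free. -/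
lemma trace_nablaK [T2Space M] (x : M) (v y : TangentSpace I x) :
    LinearMap.trace ℝ (TangentSpace I x) (S.nablaK D x v y).toLinearMap = S.nablaTau D x v y := by
  classical
  have : FiniteDimensional ℝ (TangentSpace I x) := inferInstanceAs (FiniteDimensional ℝ E)
  let e := Module.finBasis ℝ (TangentSpace I x)
  choose F hF hFe using fun i ↦ exists_global_eventuallyEq_extend (e i)
  obtain ⟨Y, hY, hYy⟩ := exists_global_eventuallyEq_extend y
  have hy : Y x = y := by rw [hYy.self_of_nhds]; simp
  have hFx : ∀ i, F i x = e i := fun i ↦ by rw [(hFe i).self_of_nhds]; simp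
  have h := mvfderiv_trace D (fun p ↦ S.K p (Y p)) e F (fun i ↦ mdiffAt_of_contMDiff (hF i) x)
    hFe (fun i ↦ mdiffAt_of_contMDiff (S.contMDiff_K hY (hF i)) x) v
  have h2 := S.nablaTau_apply D v (mdiffAt_of_contMDiff hY x)
  have htr : ∀ T : TangentSpace I x →L[ℝ] TangentSpace I x,
      LinearMap.trace ℝ (TangentSpace I x) T.toLinearMap = ∑ i, e.coord i (T (e i)) := by
    intro T
    rw [LinearMap.trace_eq_matrix_trace ℝ e]
    simp [Matrix.trace, LinearMap.toMatrix_apply]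
  simp only [czebyshev, h, htr, hy] at h2
  rw [h2, htr, ← Finset.sum_sub_distrib]
  refine Finset.sum_congr rfl fun i _ ↦ ?_
  rw [nabla_K hY (hF i), hFx, hy, ← map_sub]
  congr 1
  abel

/-- The trace of ∇K vanishes identically, so its derivative does too; the correction terms are
themselves traces of ∇K. -/
lemma sum_coord_hessK [T2Space M] (hD : D.ContMDiffCovariantDerivative ∞)
    (htau : ∀ (x : M) (u v : TangentSpace I x), S.nablaTau D x u v = 0)
    {ι : Type*} [Fintype ι] {x : M} (e : Module.Basis ι ℝ (TangentSpace I x))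
    {F : ι → ∀ p : M, TangentSpace I p}
    (hF : ∀ i, CMDiff ∞ (T% (F i))) (hFe : ∀ i, ∀ᶠ p in 𝓝 x, F i p = FiberBundle.extend E (e i) p)
    (W : ∀ p : M, TangentSpace I p) {V Y : ∀ p : M, TangentSpace I p} (hV : CMDiff ∞ (T% V))
    (hY : CMDiff ∞ (T% Y)) :
    ∑ i, e.coord i (S.hessK D x W V Y (F i)) = 0 := by
  classical
  have hFx : ∀ i, F i x = e i := fun i ↦ by rw [(hFe i).self_of_nhds]; simp
  have h := mvfderiv_trace D (fun p ↦ S.nablaK D p (V p) (Y p)) e F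
    (fun i ↦ mdiffAt_of_contMDiff (hF i) x)
    hFe (fun i ↦ mdiffAt_of_contMDiff (S.contMDiff_nablaK hD hV hY (hF i)) x) (W x)
  have htr : ∀ a b : TangentSpace I x, ∑ i, e.coord i (S.nablaK D x a b (e i)) = 0 := by
    intro a b
    rw [← htau x a b, ← trace_nablaK, LinearMap.trace_eq_matrix_trace ℝ e]
    simp [Matrix.trace, LinearMap.toMatrix_apply]
  simp only [trace_nablaK, htau, mvfderiv_const] at h
  have h2 : ∀ i, e.coord i (S.hessK D x W V Y (F i))
      = e.coord i (D (fun p ↦ S.nablaK D p (V p) (Y p) (F i p)) x (W x)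
          - S.nablaK D x (V x) (Y x) (D (F i) x (W x)))
        - e.coord i (S.nablaK D x (D V x (W x)) (Y x) (e i))
        - e.coord i (S.nablaK D x (V x) (D Y x (W x)) (e i)) := by
    intro i
    rw [hessK, hFx, ← map_sub, ← map_sub]
    congr 1
    abel
  simp only [h2, Finset.sum_sub_distrib, htr, ← h]
  simp

end StatisticalStructure

/-! ### Constant sectional `K`-curvature -/

/-- Polarization: a curvature-like expression is determined by its sectional curvatures. -/
lemma eq_swap_of_sectional {V : Type*} [AddCommGroup V] (f : V → V → V → V → ℝ)
    (hadd : ∀ a a' b c d, f (a + a') b c d = f a b c d + f a' b c d)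
    (hsymm : ∀ a b c d, f a b c d = f b a c d) (hpair : ∀ a b c d, f a b c d = f c d a b)
    (h : ∀ a c, f a a c c = f a c a c) (a b c d : V) : f a b c d = f a d c b := by
  have add2 : ∀ a b b' c d, f a (b + b') c d = f a b c d + f a b' c d := by
    intro a b b' c d
    rw [hsymm, hadd, hsymm b, hsymm b']
  have add3 : ∀ a b c c' d, f a b (c + c') d = f a b c d + f a b c' d := by
    intro a b c c' d
    rw [hpair, hadd, hpair c, hpair c']
  have add4 : ∀ a b c d d', f a b c (d + d') = f a b c d + f a b c d' := by
    intro a b c d d'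
    rw [hpair, add2, hpair c, hpair c]
  have h1 : ∀ a b c, f a b c c = f a c b c := by
    intro a b c
    have e := h (a + b) c
    simp only [hadd, add2, add3] at e
    rw [hsymm b a, hpair b c a c] at e
    linarith [h a c, h b c]
  have h2 : ∀ a b c d, 2 * f a b c d = f a c b d + f a d b c := by
    intro a b c d
    have e := h1 a b (c + d)
    simp only [add2, add3, add4] at e
    rw [hpair a b d c, hsymm d c, hpair c d] at e
    linarith [h1 a b c, h1 a b d]
  -- By the symmetries f depends only on how the arguments are paired. With values p, q, r for
  -- ab|cd, ac|bd, ad|bc, `h2` gives 2p = q + r and 2r = q + p, hence 3p = 3r.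
  have e1 := h2 a b c d
  have e2 := h2 a d c b
  rw [hpair a c d b, hsymm d b, hpair b d] at e2
  rw [hpair a d b c, hsymm b c, hpair c b] at e1
  rw [hpair a b d c, hsymm d c, hpair c d] at e2
  linarith

namespace StatisticalStructure

variable {S : StatisticalStructure I M}
  {D : CovariantDerivative I E (TangentSpace I : M → Type _)}

/-- Gram–Schmidt, keeping the coefficients so that an identity for independent a, c can be reduced
to an orthonormal pair. -/
lemma exists_orthonormal_pair (g : ContMDiffRiemannianMetric I ∞ E (TangentSpace I : M → Type _))
    {x : M} (a c : TangentSpace I x) (ha : a ≠ 0) (hac : ∀ t : ℝ, c ≠ t • a) :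
    ∃ (e₁ e₂ : TangentSpace I x) (r s t : ℝ), g.inner x e₁ e₁ = 1 ∧ g.inner x e₂ e₂ = 1 ∧
      g.inner x e₁ e₂ = 0 ∧ a = r • e₁ ∧ c = s • e₁ + t • e₂ := by
  have haa := g.pos x a ha
  have hc' : c - (g.inner x a c / g.inner x a a) • a ≠ 0 := fun h ↦ hac _ (sub_eq_zero.1 h)
  set c' := c - (g.inner x a c / g.inner x a a) • a with hc'_def
  have hcc := g.pos x c' hc'
  have horth : g.inner x a c' = 0 := by
    simp only [hc'_def, map_sub, map_smul, smul_eq_mul]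
    field_simp
    simp
  have norm : ∀ u : TangentSpace I x, 0 < g.inner x u u →
      g.inner x ((√(g.inner x u u))⁻¹ • u) ((√(g.inner x u u))⁻¹ • u) = 1 := by
    intro u hu
    simp only [map_smul, smul_apply, smul_eq_mul]
    have := Real.mul_self_sqrt hu.le
    have h0 := (Real.sqrt_pos.2 hu).ne'
    field_simp
    nlinarith
  refine ⟨(√(g.inner x a a))⁻¹ • a, (√(g.inner x c' c'))⁻¹ • c', √(g.inner x a a),
    g.inner x a c / g.inner x a a * √(g.inner x a a), √(g.inner x c' c'), norm a haa, norm c' hcc,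
    ?_, ?_, ?_⟩
  · simp [horth]
  · rw [smul_inv_smul₀ (Real.sqrt_pos.2 haa).ne']
  · rw [mul_smul, smul_inv_smul₀ (Real.sqrt_pos.2 haa).ne',
      smul_inv_smul₀ (Real.sqrt_pos.2 hcc).ne', hc'_def]
    abel

namespace HasConstantSectionalKCurvature

variable {κ : ℝ}

/-- `[K, K](a, c) = κ a ∧ c`, with all arguments paired with the metric. -/
lemma inner_K_K (hK : S.HasConstantSectionalKCurvature κ) (x : M) (a b c d : TangentSpace I x) :
    S.g.inner x (S.K x a b) (S.K x c d) - S.g.inner x (S.K x a d) (S.K x c b)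
      = κ * (S.g.inner x a b * S.g.inner x c d - S.g.inner x a d * S.g.inner x c b) := by
  have key := eq_swap_of_sectional (V := TangentSpace I x)
    (fun a b c d ↦ S.g.inner x (S.K x a b) (S.K x c d) - κ * (S.g.inner x a b * S.g.inner x c d))
    (by intros; simp only [map_add, add_apply]; ring)
    (by intro a b c d; simp only [S.symm x a b, S.g.symm x a b])
    (by intro a b c d; simp only [S.g.symm x (S.K x a b), mul_comm (S.g.inner x a b)])
    (by
      intro a c
      by_cases ha : a = 0
      · simp [ha]
      by_cases hac : ∀ t : ℝ, c ≠ t • a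
      · obtain ⟨e₁, e₂, r, s, t, h11, h22, h12, rfl, rfl⟩ := exists_orthonormal_pair S.g a c ha hac
        have h := hK x e₁ e₂ h11 h22 h12
        have h21 : S.g.inner x e₂ e₁ = 0 := by rw [S.g.symm, h12]
        rw [bracketK, map_sub, sub_apply, S.symm_g x e₁ (S.K x e₂ e₂) e₁,
          S.symm_g x e₂ (S.K x e₁ e₂) e₁, S.symm x e₂ e₁, S.g.symm x (S.K x e₂ e₂)] at h
        simp only [map_add, map_smul, add_apply, smul_apply, smul_eq_mul, h11, h22, h12, h21,
          S.symm x e₂ e₁]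
        rw [S.g.symm x (S.K x e₁ e₂) (S.K x e₁ e₁)]
        -- The s-terms cancel; (rt)² is the squared area of the parallelogram on a and c.
        linear_combination (r ^ 2 * t ^ 2) * h
      · push Not at hac
        obtain ⟨t, rfl⟩ := hac
        simp only [map_smul, smul_apply, smul_eq_mul]
        ring)
    a b c d
  linear_combination key

/-- The derivative of `inner_K_K`: g is parallel and κ constant, so the right-hand side leaves no
term. -/
lemma inner_nablaK_K [T2Space M] (hD : IsLeviCivita S.g D)
    (hK : S.HasConstantSectionalKCurvature κ) (x : M) (v a b c d : TangentSpace I x) :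
    S.g.inner x (S.nablaK D x v a b) (S.K x c d) + S.g.inner x (S.K x a b) (S.nablaK D x v c d)
      = S.g.inner x (S.nablaK D x v a d) (S.K x c b)
        + S.g.inner x (S.K x a d) (S.nablaK D x v c b) := by
  obtain ⟨A, hA, hAa⟩ := exists_global_eventuallyEq_extend a
  obtain ⟨B, hB, hBb⟩ := exists_global_eventuallyEq_extend b
  obtain ⟨C, hC, hCc⟩ := exists_global_eventuallyEq_extend c
  obtain ⟨U, hU, hUd⟩ := exists_global_eventuallyEq_extend d
  have ha : A x = a := by rw [hAa.self_of_nhds]; simp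
  have hb : B x = b := by rw [hBb.self_of_nhds]; simp
  have hc : C x = c := by rw [hCc.self_of_nhds]; simp
  have hd : U x = d := by rw [hUd.self_of_nhds]; simp
  have df : ∀ {X Y : ∀ p : M, TangentSpace I p}, CMDiff ∞ (T% X) → CMDiff ∞ (T% Y) →
      MDiffAt (fun p ↦ S.g.inner p (X p) (Y p)) x := fun hX hY ↦
    (contMDiff_inner S.g hX hY).mdifferentiable (by simp) x
  have h : (fun p ↦ S.g.inner p (S.K p (A p) (B p)) (S.K p (C p) (U p)))
      - (fun p ↦ S.g.inner p (S.K p (A p) (U p)) (S.K p (C p) (B p)))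
      = (fun _ ↦ κ) * ((fun p ↦ S.g.inner p (A p) (B p)) * (fun p ↦ S.g.inner p (C p) (U p))
        - (fun p ↦ S.g.inner p (A p) (U p)) * (fun p ↦ S.g.inner p (C p) (B p))) := by
    ext p
    exact hK.inner_K_K p _ _ _ _
  have h1 := congr(d% $h x v)
  rw [mvfderiv_sub (df (S.contMDiff_K hA hB) (S.contMDiff_K hC hU))
      (df (S.contMDiff_K hA hU) (S.contMDiff_K hC hB)),
    mvfderiv_mul mdifferentiableAt_const
      (((df hA hB).mul (df hC hU)).sub ((df hA hU).mul (df hC hB))),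
    mvfderiv_sub ((df hA hB).mul (df hC hU)) ((df hA hU).mul (df hC hB)),
    mvfderiv_mul (df hA hB) (df hC hU), mvfderiv_mul (df hA hU) (df hC hB), mvfderiv_const] at h1
  simp only [sub_apply, add_apply, smul_apply, smul_eq_mul, zero_apply, mul_zero, add_zero,
    hD.mvfderiv_inner (S.contMDiff_K hA hB) (S.contMDiff_K hC hU),
    hD.mvfderiv_inner (S.contMDiff_K hA hU) (S.contMDiff_K hC hB),
    hD.mvfderiv_inner hA hB, hD.mvfderiv_inner hA hU, hD.mvfderiv_inner hC hU,
    hD.mvfderiv_inner hC hB,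
    nabla_K hA hB, nabla_K hA hU, nabla_K hC hB, nabla_K hC hU, map_add, ha, hb, hc, hd] at h1
  -- Derivatives falling on the arguments are removed by the undifferentiated identity.
  have e1 := hK.inner_K_K x (D A x v) b c d
  have e2 := hK.inner_K_K x a (D B x v) c d
  have e3 := hK.inner_K_K x a b (D C x v) d
  have e4 := hK.inner_K_K x a b c (D U x v)
  linear_combination h1 - e1 - e2 - e3 - e4

/-- `inner_nablaK_K` differentiated once more; its own instances absorb the derivatives of the
arguments. -/
lemma inner_hessK_K [T2Space M] (hD : IsLeviCivita S.g D)
    (hK : S.HasConstantSectionalKCurvature κ) {V A B C U : ∀ p : M, TangentSpace I p}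
    (hV : CMDiff ∞ (T% V)) (hA : CMDiff ∞ (T% A)) (hB : CMDiff ∞ (T% B)) (hC : CMDiff ∞ (T% C))
    (hU : CMDiff ∞ (T% U)) (W : ∀ p : M, TangentSpace I p) (x : M) :
    S.g.inner x (S.hessK D x W V A B) (S.K x (C x) (U x))
        + S.g.inner x (S.nablaK D x (V x) (A x) (B x)) (S.nablaK D x (W x) (C x) (U x))
        + S.g.inner x (S.nablaK D x (W x) (A x) (B x)) (S.nablaK D x (V x) (C x) (U x))
        + S.g.inner x (S.K x (A x) (B x)) (S.hessK D x W V C U)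
      = S.g.inner x (S.hessK D x W V A U) (S.K x (C x) (B x))
        + S.g.inner x (S.nablaK D x (V x) (A x) (U x)) (S.nablaK D x (W x) (C x) (B x))
        + S.g.inner x (S.nablaK D x (W x) (A x) (U x)) (S.nablaK D x (V x) (C x) (B x))
        + S.g.inner x (S.K x (A x) (U x)) (S.hessK D x W V C B) := by
  have df : ∀ {X Y : ∀ p : M, TangentSpace I p}, CMDiff ∞ (T% X) → CMDiff ∞ (T% Y) →
      MDiffAt (fun p ↦ S.g.inner p (X p) (Y p)) x := fun hX hY ↦
    (contMDiff_inner S.g hX hY).mdifferentiable (by simp) x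
  have h : (fun p ↦ S.g.inner p (S.nablaK D p (V p) (A p) (B p)) (S.K p (C p) (U p)))
        + (fun p ↦ S.g.inner p (S.K p (A p) (B p)) (S.nablaK D p (V p) (C p) (U p)))
      = (fun p ↦ S.g.inner p (S.nablaK D p (V p) (A p) (U p)) (S.K p (C p) (B p)))
        + (fun p ↦ S.g.inner p (S.K p (A p) (U p)) (S.nablaK D p (V p) (C p) (B p))) := by
    ext p
    exact hK.inner_nablaK_K hD p _ _ _ _ _
  have kAB := S.contMDiff_K hA hB
  have kAU := S.contMDiff_K hA hU
  have kCB := S.contMDiff_K hC hB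
  have kCU := S.contMDiff_K hC hU
  have nAB := S.contMDiff_nablaK hD.smooth hV hA hB
  have nAU := S.contMDiff_nablaK hD.smooth hV hA hU
  have nCB := S.contMDiff_nablaK hD.smooth hV hC hB
  have nCU := S.contMDiff_nablaK hD.smooth hV hC hU
  have h1 := congr(d% $h x (W x))
  rw [mvfderiv_add (df nAB kCU) (df kAB nCU), mvfderiv_add (df nAU kCB) (df kAU nCB)] at h1
  simp only [add_apply, hD.mvfderiv_inner nAB kCU, hD.mvfderiv_inner kAB nCU,
    hD.mvfderiv_inner nAU kCB, hD.mvfderiv_inner kAU nCB,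
    nabla_K hA hB, nabla_K hA hU, nabla_K hC hB, nabla_K hC hU, nabla_nablaK, map_add] at h1
  have e0 := hK.inner_nablaK_K hD x (D V x (W x)) (A x) (B x) (C x) (U x)
  have e1 := hK.inner_nablaK_K hD x (V x) (D A x (W x)) (B x) (C x) (U x)
  have e2 := hK.inner_nablaK_K hD x (V x) (A x) (D B x (W x)) (C x) (U x)
  have e3 := hK.inner_nablaK_K hD x (V x) (A x) (B x) (D C x (W x)) (U x)
  have e4 := hK.inner_nablaK_K hD x (V x) (A x) (B x) (C x) (D U x (W x))
  linear_combination h1 - e0 - e1 - e2 - e3 - e4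

end HasConstantSectionalKCurvature

end StatisticalStructure

/-! ### The Bochner formula in components -/

section Sums

variable {ι : Type*} [Fintype ι]

lemma sum_rotate_three (f : ι → ι → ι → ℝ) :
    ∑ i, ∑ j, ∑ k, f i j k = ∑ k, ∑ i, ∑ j, f i j k := by
  rw [Finset.sum_comm]
  simp_rw [Finset.sum_comm (f := fun i k ↦ f i _ k)]
  rw [Finset.sum_comm]
  refine Finset.sum_congr rfl fun k _ ↦ Finset.sum_comm

lemma sum_rotate_four (f : ι → ι → ι → ι → ℝ) :
    ∑ l, ∑ i, ∑ j, ∑ k, f l i j k = ∑ i, ∑ j, ∑ k, ∑ l, f l i j k := by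
  rw [Finset.sum_comm]
  exact Finset.sum_congr rfl fun i _ ↦ (sum_rotate_three fun j k l ↦ f l i j k).symm

lemma sum_reorder_five (f : ι → ι → ι → ι → ι → ℝ) :
    ∑ i, ∑ j, ∑ k, ∑ l, ∑ m, f i j k l m = ∑ l, ∑ i, ∑ j, ∑ m, ∑ k, f i j k l m := by
  rw [sum_rotate_four fun l i j m ↦ ∑ k, f i j k l m]
  refine Finset.sum_congr rfl fun i _ ↦ Finset.sum_congr rfl fun j _ ↦ ?_
  rw [sum_rotate_three]
  refine Finset.sum_congr rfl fun m _ ↦ Finset.sum_comm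

end Sums

/-- The Bochner formula in an orthonormal basis: `a`, `N`, `h` and `r` are the components of
`K`, `∇K`, `∇²K` and of the curvature tensor. -/
lemma bochner_components {ι : Type*} [Fintype ι] [DecidableEq ι] {a : ι → ι → ι → ℝ}
    {N r : ι → ι → ι → ι → ℝ} {h : ι → ι → ι → ι → ι → ℝ} {κ : ℝ}
    (ha₁ : ∀ i j k, a i j k = a j i k) (ha₂ : ∀ i j k, a i j k = a i k j)
    (hN : ∀ l i j k, N l i j k = N l j i k) (hNtr : ∀ l k, ∑ i, N l i i k = 0)
    (hh₁ : ∀ w v i j k, h w v i j k = h w i v j k) (hh₂ : ∀ w v i j k, h w v i j k = h w v j i k)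
    (hh₃ : ∀ w v i j k, h w v i j k = h w v i k j) (hhtr : ∀ w v i, ∑ l, h w v i l l = 0)
    (hr₁ : ∀ i j k m, r i j k m = - r j i k m) (hr₂ : ∀ i j k m, r i j k m = - r i j m k)
    (hcomm : ∀ w v j k u, h w v j k u - h v w j k u
      = - ∑ m, (r w v u m * a j k m + r w v j m * a m k u + r w v k m * a j m u))
    (hκ : ∀ i j k l, ∑ m, (a i j m * a k l m - a i l m * a k j m)
      = κ * ((if i = j then 1 else 0) * (if k = l then 1 else 0)
        - (if i = l then 1 else 0) * (if k = j then 1 else 0)))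
    (hbo : ∀ l i j, ∑ k, (h l l i i k * a j j k + 2 * (N l i i k * N l j j k)
        + a i i k * h l l j j k)
      = ∑ k, (h l l i j k * a j i k + 2 * (N l i j k * N l j i k) + a i j k * h l l j i k)) :
    ∑ l, ∑ i, ∑ j, ∑ k, N l i j k ^ 2
      + ∑ j, ∑ k, ∑ i, ∑ m, (∑ l, r l i m l) * a i j k * a m j k
      - 2 * κ * ∑ i, ∑ l, r l i i l = 0 := by
  have hhtr' : ∀ l k, ∑ i, h l l i i k = 0 := by
    intro l k
    rw [← hhtr l l k]
    refine Finset.sum_congr rfl fun i _ ↦ ?_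
    rw [hh₃, hh₂]
  -- Sum `hbo` over i and j: every term on the left contains a vanishing trace, and the right is
  -- 2(|N|² + ⟨Δa, a⟩).
  have b1 : ∑ l, ∑ i, ∑ j, ∑ k, N l i j k ^ 2
      = - ∑ l, ∑ i, ∑ j, ∑ k, h l l i j k * a i j k := by
    rw [← Finset.sum_neg_distrib]
    refine Finset.sum_congr rfl fun l _ ↦ ?_
    have e1 : ∑ i, ∑ j, ∑ k, (h l l i i k * a j j k + 2 * (N l i i k * N l j j k)
        + a i i k * h l l j j k) = 0 := by
      have : ∀ k, ∑ i, ∑ j, (h l l i i k * a j j k + 2 * (N l i i k * N l j j k)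
          + a i i k * h l l j j k) = 0 := by
        intro k
        simp only [Finset.sum_add_distrib, ← Finset.mul_sum, ← Finset.sum_mul, hhtr', hNtr]
        simp
      calc _ = ∑ k, ∑ i, ∑ j, (h l l i i k * a j j k + 2 * (N l i i k * N l j j k)
          + a i i k * h l l j j k) := by
            exact sum_rotate_three _
        _ = 0 := by simp [this]
    have e2 : ∑ i, ∑ j, ∑ k, (h l l i j k * a j i k + 2 * (N l i j k * N l j i k)
        + a i j k * h l l j i k) = 0 := by
      rw [← e1]
      exact Finset.sum_congr rfl fun i _ ↦ Finset.sum_congr rfl fun j _ ↦ (hbo l i j).symm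
    have e3 : ∀ i j k, h l l i j k * a j i k + 2 * (N l i j k * N l j i k) + a i j k * h l l j i k
        = 2 * (N l i j k ^ 2 + h l l i j k * a i j k) := by
      intro i j k
      rw [ha₁ j i, hN l j i, hh₂ l l j i]
      ring
    simp only [e3, ← Finset.mul_sum, Finset.sum_add_distrib] at e2
    linarith
  -- Write h l l i as h l i l and commute the derivatives l and i; the resulting h i l l is
  -- trace-free.
  have b2 : ∀ i j k, ∑ l, h l l i j k
      = - ∑ l, ∑ m, (r l i k m * a l j m + r l i l m * a m j k + r l i j m * a l m k) := by
    intro i j k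
    have e : ∑ l, h i l l j k = 0 := by
      rw [← hhtr i j k]
      refine Finset.sum_congr rfl fun l _ ↦ ?_
      rw [hh₂, hh₁, hh₃, hh₂, hh₃]
    rw [← Finset.sum_neg_distrib, ← sub_zero (∑ l, h l l i j k), ← e, ← Finset.sum_sub_distrib]
    refine Finset.sum_congr rfl fun l _ ↦ ?_
    rw [hh₁ l l i, hcomm]
  -- As r is skew in l, i, only the skew part of the quadratic factor in a counts, and `hκ`
  -- evaluates it; each Kronecker product contributes κ scal to twice the sum.
  have b3 : ∑ i, ∑ j, ∑ k, (∑ l, ∑ m, r l i j m * a l m k) * a i j k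
      = κ * ∑ i, ∑ l, r l i i l := by
    simp only [Finset.sum_mul]
    rw [sum_reorder_five]
    have e1 : ∀ l i j m, ∑ k, r l i j m * a l m k * a i j k
        = r l i j m * ∑ k, a l m k * a i j k := by
      intro l i j m
      rw [Finset.mul_sum]
      exact Finset.sum_congr rfl fun k _ ↦ by ring
    simp only [e1]
    have e2 : ∑ l, ∑ i, ∑ j, ∑ m, r l i j m * ∑ k, a l m k * a i j k
        = - ∑ l, ∑ i, ∑ j, ∑ m, r l i j m * ∑ k, a i m k * a l j k := by
      rw [Finset.sum_comm]
      simp only [← Finset.sum_neg_distrib]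
      refine Finset.sum_congr rfl fun l _ ↦ Finset.sum_congr rfl fun i _ ↦
        Finset.sum_congr rfl fun j _ ↦ Finset.sum_congr rfl fun m _ ↦ ?_
      rw [hr₁ i l]
      ring
    have e3 : ∑ l, ∑ i, ∑ j, ∑ m, r l i j m * ∑ k, a l m k * a i j k
        - ∑ l, ∑ i, ∑ j, ∑ m, r l i j m * ∑ k, a i m k * a l j k
        = ∑ l, ∑ i, ∑ j, ∑ m, r l i j m * (κ * ((if l = m then 1 else 0) *
          (if i = j then 1 else 0) - (if l = j then 1 else 0) * (if i = m then 1 else 0))) := by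
      simp only [← Finset.sum_sub_distrib, ← mul_sub]
      refine Finset.sum_congr rfl fun l _ ↦ Finset.sum_congr rfl fun i _ ↦
        Finset.sum_congr rfl fun j _ ↦ Finset.sum_congr rfl fun m _ ↦ ?_
      rw [← hκ l m i j]
      simp only [mul_comm (a l j _)]
    have e4 : ∑ l, ∑ i, ∑ j, ∑ m, r l i j m * (κ * ((if l = m then 1 else 0) *
          (if i = j then 1 else 0) - (if l = j then 1 else 0) * (if i = m then 1 else 0)))
        = 2 * κ * ∑ i, ∑ l, r l i i l := by
      rw [Finset.sum_comm, Finset.mul_sum]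
      refine Finset.sum_congr rfl fun i _ ↦ ?_
      rw [Finset.mul_sum]
      refine Finset.sum_congr rfl fun l _ ↦ ?_
      have e5 : ∀ j m, r l i j m * (κ * ((if l = m then 1 else 0) * (if i = j then 1 else 0)
          - (if l = j then 1 else 0) * (if i = m then 1 else 0)))
          = (if i = j then (if l = m then κ * r l i j m else 0) else 0)
            - (if l = j then (if i = m then κ * r l i j m else 0) else 0) := by
        intro j m
        split_ifs <;> ring
      simp only [e5, Finset.sum_sub_distrib]
      simp
      rw [hr₂ l i l i]
      ring
    linarith
  have b4 : ∑ i, ∑ j, ∑ k, (∑ l, ∑ m, r l i k m * a l j m) * a i j k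
      = κ * ∑ i, ∑ l, r l i i l := by
    rw [← b3]
    refine Finset.sum_congr rfl fun i _ ↦ ?_
    rw [Finset.sum_comm]
    refine Finset.sum_congr rfl fun j _ ↦ Finset.sum_congr rfl fun k _ ↦ ?_
    rw [ha₂ i k j]
    simp only [ha₂ _ k _]
  -- The remaining curvature term has l contracted inside r, which is the Ricci tensor up to sign.
  have b5 : ∑ j, ∑ k, ∑ i, ∑ m, (∑ l, r l i m l) * a i j k * a m j k
      = - ∑ i, ∑ j, ∑ k, (∑ l, ∑ m, r l i l m * a m j k) * a i j k := by
    rw [sum_rotate_three, ← Finset.sum_neg_distrib]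
    refine Finset.sum_congr rfl fun i _ ↦ ?_
    rw [← Finset.sum_neg_distrib]
    refine Finset.sum_congr rfl fun j _ ↦ ?_
    rw [← Finset.sum_neg_distrib]
    refine Finset.sum_congr rfl fun k _ ↦ ?_
    rw [Finset.sum_comm (f := fun l m ↦ r l i l m * a m j k), Finset.sum_mul,
      ← Finset.sum_neg_distrib]
    refine Finset.sum_congr rfl fun m _ ↦ ?_
    rw [Finset.sum_mul, Finset.sum_mul, Finset.sum_mul, ← Finset.sum_neg_distrib]
    refine Finset.sum_congr rfl fun l _ ↦ ?_
    rw [hr₂ l i m l]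
    ring
  rw [sum_rotate_four fun l i j k ↦ h l l i j k * a i j k] at b1
  simp only [← Finset.sum_mul, b2, Finset.sum_add_distrib, neg_mul, add_mul,
    Finset.sum_neg_distrib, b3, b4] at b1
  rw [b1, b5]
  ring

/-! ### The Bochner formula -/

/-- The inner product structure from g is local to the proof, since the tangent space already
carries the model topology; only an algebraic basis leaves it. -/
lemma exists_orthonormal_basis (g : ContMDiffRiemannianMetric I ∞ E (TangentSpace I : M → Type _))
    (x : M) : ∃ (n : ℕ) (e : Module.Basis (Fin n) ℝ (TangentSpace I x)),
      ∀ i j, g.inner x (e i) (e j) = if i = j then 1 else 0 := by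
  have : FiniteDimensional ℝ (TangentSpace I x) := inferInstanceAs (FiniteDimensional ℝ E)
  let core : InnerProductSpace.Core ℝ (TangentSpace I x) := g.toRiemannianMetric.toCore x
  let := core.toNormedAddCommGroup
  let := InnerProductSpace.ofCore core.toCore
  have : FiniteDimensional ℝ (TangentSpace I x) := inferInstanceAs (FiniteDimensional ℝ E)
  let b := stdOrthonormalBasis ℝ (TangentSpace I x)
  exact ⟨_, b.toBasis, fun i j ↦ by
    rw [b.coe_toBasis]
    exact orthonormal_iff_ite.1 b.orthonormal i j⟩

/-! ### Components in an orthonormal basis -/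

section Orthonormal

variable {g : ContMDiffRiemannianMetric I ∞ E (TangentSpace I : M → Type _)} {x : M}
  {ι : Type*} [Fintype ι] [DecidableEq ι] {e : Module.Basis ι ℝ (TangentSpace I x)}
  (he : ∀ i j, g.inner x (e i) (e j) = if i = j then 1 else 0)

include he

lemma repr_eq_inner (u : TangentSpace I x) (i : ι) : e.repr u i = g.inner x u (e i) := by
  conv_rhs => rw [← e.sum_repr u, map_sum, sum_apply]
  simp [-Module.Basis.sum_repr, he]

lemma sum_inner_smul (u : TangentSpace I x) : ∑ i, g.inner x u (e i) • e i = u := by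
  simp only [← repr_eq_inner he, e.sum_repr]

lemma inner_eq_sum (u v : TangentSpace I x) :
    g.inner x u v = ∑ i, g.inner x u (e i) * g.inner x v (e i) := by
  conv_lhs => rw [← sum_inner_smul he v, map_sum]
  simp [mul_comm]

lemma trace_eq_sum_inner (T : TangentSpace I x →ₗ[ℝ] TangentSpace I x) :
    LinearMap.trace ℝ (TangentSpace I x) T = ∑ i, g.inner x (T (e i)) (e i) := by
  rw [LinearMap.trace_eq_matrix_trace ℝ e]
  simp [Matrix.trace, LinearMap.toMatrix_apply, repr_eq_inner he]

end Orthonormal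

/-! ### Symmetries of the curvature and Ricci tensors -/

section Curvature

variable [T2Space M] {g : ContMDiffRiemannianMetric I ∞ E (TangentSpace I : M → Type _)}
  {D : CovariantDerivative I E (TangentSpace I : M → Type _)} (hD : IsLeviCivita g D)

lemma inner_curvature_skew (x : M) (u v w z : TangentSpace I x) :
    g.inner x (curvature D hD.smooth x w u v) z
      = - g.inner x (curvature D hD.smooth x z u v) w := by
  obtain ⟨U, hU, hUu⟩ := exists_global_eventuallyEq_extend u
  obtain ⟨V, hV, hVv⟩ := exists_global_eventuallyEq_extend v
  obtain ⟨W, hW, hWw⟩ := exists_global_eventuallyEq_extend w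
  obtain ⟨Z, hZ, hZz⟩ := exists_global_eventuallyEq_extend z
  have hu : U x = u := by rw [hUu.self_of_nhds]; simp
  have hv : V x = v := by rw [hVv.self_of_nhds]; simp
  have hw : W x = w := by rw [hWw.self_of_nhds]; simp
  have hz : Z x = z := by rw [hZz.self_of_nhds]; simp
  have h := hD.inner_curvatureAux_skew hU hV hW hZ x
  rw [← curvature_eq_curvatureAux hD.smooth hU hV hW hWw,
    ← curvature_eq_curvatureAux hD.smooth hU hV hZ hZz, hu, hv, hw, hz] at h
  rw [h, g.symm]

lemma curvature_swap (x : M) (u v w : TangentSpace I x) :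
    curvature D hD.smooth x w u v = - curvature D hD.smooth x w v u := by
  obtain ⟨U, hU, hUu⟩ := exists_global_eventuallyEq_extend u
  obtain ⟨V, hV, hVv⟩ := exists_global_eventuallyEq_extend v
  obtain ⟨W, hW, hWw⟩ := exists_global_eventuallyEq_extend w
  have hu : U x = u := by rw [hUu.self_of_nhds]; simp
  have hv : V x = v := by rw [hVv.self_of_nhds]; simp
  rw [← hu, ← hv, curvature_eq_curvatureAux hD.smooth hU hV hW hWw,
    curvature_eq_curvatureAux hD.smooth hV hU hW hWw, curvatureAux, curvatureAux,
    VectorField.mlieBracket_swap_apply, map_neg]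
  abel

lemma curvature_bianchi (x : M) (u v w : TangentSpace I x) :
    curvature D hD.smooth x w u v + curvature D hD.smooth x u v w
      + curvature D hD.smooth x v w u = 0 := by
  obtain ⟨U, hU, hUu⟩ := exists_global_eventuallyEq_extend u
  obtain ⟨V, hV, hVv⟩ := exists_global_eventuallyEq_extend v
  obtain ⟨W, hW, hWw⟩ := exists_global_eventuallyEq_extend w
  have hu : U x = u := by rw [hUu.self_of_nhds]; simp
  have hv : V x = v := by rw [hVv.self_of_nhds]; simp
  have hw : W x = w := by rw [hWw.self_of_nhds]; simp
  have h := hD.curvatureAux_bianchi hU hV hW x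
  rwa [← curvature_eq_curvatureAux hD.smooth hU hV hW hWw,
    ← curvature_eq_curvatureAux hD.smooth hV hW hU hUu,
    ← curvature_eq_curvatureAux hD.smooth hW hU hV hVv, hu, hv, hw] at h

section Ricci

variable {x : M} {ι : Type*} [Fintype ι] [DecidableEq ι]
  {e : Module.Basis ι ℝ (TangentSpace I x)}
  (he : ∀ i j, g.inner x (e i) (e j) = if i = j then 1 else 0)

include he

lemma ricci_eq_sum (v w : TangentSpace I x) :
    ricci D hD.smooth x v w = ∑ l, g.inner x (curvature D hD.smooth x w (e l) v) (e l) :=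
  trace_eq_sum_inner he _

/-- `curvature` is bundled as linear only in the two directions of R. Skew-symmetry moves w into the
metric, where linearity in w is visible. -/
lemma ricci_eq_neg_sum (v w : TangentSpace I x) :
    ricci D hD.smooth x v w = - ∑ l, g.inner x (curvature D hD.smooth x (e l) (e l) v) w := by
  rw [ricci_eq_sum hD he, ← Finset.sum_neg_distrib]
  exact Finset.sum_congr rfl fun l _ ↦ inner_curvature_skew hD x _ _ _ _

/-- Pair the Bianchi identity for e_l, v, w with e_l: the term R(v, w) e_l drops out by skewness. -/
lemma ricci_symm (v w : TangentSpace I x) :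
    ricci D hD.smooth x v w = ricci D hD.smooth x w v := by
  rw [ricci_eq_sum hD he, ricci_eq_sum hD he]
  refine Finset.sum_congr rfl fun l _ ↦ ?_
  have h := congr(g.inner x $(curvature_bianchi hD x (e l) v w) (e l))
  have h2 := inner_curvature_skew hD x v w (e l) (e l)
  rw [curvature_swap hD x w (e l) v] at h
  simp only [map_add, add_apply, map_neg, neg_apply, map_zero, zero_apply] at h
  linarith

lemma ricci_sum_smul (c d : ι → ℝ) :
    ricci D hD.smooth x (∑ i, c i • e i) (∑ i, d i • e i)
      = ∑ i, ∑ j, ricci D hD.smooth x (e i) (e j) * c i * d j := by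
  have key : ∀ l, g.inner x (curvature D hD.smooth x (e l) (e l) (∑ i, c i • e i))
      (∑ i, d i • e i)
      = ∑ i, ∑ j, g.inner x (curvature D hD.smooth x (e l) (e l) (e i)) (e j) * c i * d j := by
    intro l
    rw [map_sum (curvature D hD.smooth x (e l) (e l)), map_sum (g.inner x), sum_apply]
    refine Finset.sum_congr rfl fun i _ ↦ ?_
    rw [map_smul, map_smul, smul_apply, map_sum, smul_eq_mul, Finset.mul_sum]
    refine Finset.sum_congr rfl fun j _ ↦ ?_
    rw [map_smul, smul_eq_mul]
    ring
  simp only [ricci_eq_neg_sum hD he, key, neg_mul, Finset.sum_neg_distrib, Finset.sum_mul]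
  rw [← sum_rotate_three]

/-- A nonnegative Ricci tensor with vanishing scalar curvature is zero. -/
lemma ricci_eq_zero_of_sum_eq_zero (hric : ∀ v, 0 ≤ ricci D hD.smooth x v v)
    (h : ∑ i, ricci D hD.smooth x (e i) (e i) = 0) (v w : TangentSpace I x) :
    ricci D hD.smooth x v w = 0 := by
  have hii := fun i ↦ (Finset.sum_eq_zero_iff_of_nonneg fun i _ ↦ hric (e i)).1 h i
    (Finset.mem_univ i)
  have hij : ∀ i j, ricci D hD.smooth x (e i) (e j) = 0 := by
    intro i j
    -- With zero diagonal, Ric(e_i ± e_j, e_i ± e_j) = ±2 Ric(e_i, e_j), and both signs are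
    -- nonnegative.
    have h1 := hric (e i + e j)
    have h2 := hric (e i - e j)
    have h3 := ricci_symm hD he (e i) (e j)
    have hi := hii i
    have hj := hii j
    simp only [ricci_eq_neg_sum hD he, map_add, map_sub, add_apply, sub_apply,
      Finset.sum_add_distrib, Finset.sum_sub_distrib] at h1 h2 h3 hi hj ⊢
    linarith
  rw [← e.sum_repr v, ← e.sum_repr w, ricci_sum_smul hD he]
  simp [hij]

end Ricci

end Curvature

namespace StatisticalStructure

variable {S : StatisticalStructure I M} [T2Space M]
  {D : CovariantDerivative I E (TangentSpace I : M → Type _)}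

/-- The Bochner formula `|∇K|² + ∑ Ric (K(eⱼ, eₖ), K(eⱼ, eₖ)) - 2 κ scal = 0`. -/
lemma bochner_formula (hD : IsLeviCivita S.g D) (hconj : S.IsConjugateSymmetric D)
    (htau : ∀ (x : M) (u v : TangentSpace I x), S.nablaTau D x u v = 0) {κ : ℝ}
    (hK : S.HasConstantSectionalKCurvature κ) {x : M} {ι : Type*} [Fintype ι] [DecidableEq ι]
    {e : Module.Basis ι ℝ (TangentSpace I x)}
    (he : ∀ i j, S.g.inner x (e i) (e j) = if i = j then 1 else 0) :
    ∑ l, ∑ i, ∑ j, ∑ k, S.g.inner x (S.nablaK D x (e l) (e i) (e j)) (e k) ^ 2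
      + ∑ j, ∑ k, ricci D hD.smooth x (S.K x (e j) (e k)) (S.K x (e j) (e k))
      - 2 * κ * ∑ i, ricci D hD.smooth x (e i) (e i) = 0 := by
  choose F hF hFe using fun i ↦ exists_global_eventuallyEq_extend (e i)
  have hFx : ∀ i, F i x = e i := fun i ↦ by rw [(hFe i).self_of_nhds]; simp
  have hcurv : ∀ i j k, curvatureAux D x (F i) (F j) (F k)
      = curvature D hD.smooth x (e k) (e i) (e j) := by
    intro i j k
    rw [← curvature_eq_curvatureAux hD.smooth (hF i) (hF j) (hF k) (hFe k), hFx, hFx]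
  have hNsymm : ∀ u v w, S.nablaK D x u v w = S.nablaK D x v u w := fun u v w ↦ (hconj x u v w).1
  have hNsymm' : ∀ u v w, S.nablaK D x u v w = S.nablaK D x u w v := fun u v w ↦ (hconj x u v w).2
  have htr : ∀ l k, ∑ i, S.g.inner x (S.nablaK D x (e l) (e k) (e i)) (e i) = 0 := by
    intro l k
    rw [← htau x (e l) (e k), ← trace_nablaK, trace_eq_sum_inner he]
    rfl
  have hlin : ∀ u v w, S.g.inner x (S.K x u v) w
      = ∑ m, S.g.inner x u (e m) * S.g.inner x (S.K x (e m) v) w := by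
    intro u v w
    conv_lhs => rw [← sum_inner_smul he u, map_sum, sum_apply, map_sum, sum_apply]
    simp
  have b := bochner_components (κ := κ)
    (a := fun i j k ↦ S.g.inner x (S.K x (e i) (e j)) (e k))
    (N := fun l i j k ↦ S.g.inner x (S.nablaK D x (e l) (e i) (e j)) (e k))
    (r := fun i j k m ↦ S.g.inner x (curvature D hD.smooth x (e k) (e i) (e j)) (e m))
    (h := fun w v i j k ↦ S.g.inner x (S.hessK D x (F w) (F v) (F i) (F j)) (e k))
    (fun i j k ↦ by rw [S.symm])
    (fun i j k ↦ by rw [S.symm_g, S.g.symm])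
    (fun l i j k ↦ by rw [hNsymm'])
    (fun l k ↦ by
      rw [← htr l k]
      refine Finset.sum_congr rfl fun i _ ↦ ?_
      rw [inner_nablaK hD, S.g.symm, hNsymm' _ _ (e k)])
    (fun w v i j k ↦ by rw [hconj.hessK_swap_left])
    (fun w v i j k ↦ by rw [hconj.hessK_swap_right])
    (fun w v i j k ↦ by
      rw [← hFx k, inner_hessK hD (hF v) (hF i) (hF j) (hF k), S.g.symm, hFx])
    (fun w v i ↦ by
      have h := sum_coord_hessK hD.smooth htau e hF hFe (F w) (hF v) (hF i)
      simpa only [Module.Basis.coord_apply, repr_eq_inner he] using h)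
    (fun i j k m ↦ by rw [curvature_swap hD, map_neg, neg_apply])
    (fun i j k m ↦ inner_curvature_skew hD x _ _ _ _)
    (fun w v j k u ↦ by
      rw [← sub_apply, ← map_sub, hessK_sub_hessK hD (hF w) (hF v) (hF j) (hF k), map_sub,
        map_sub, sub_apply, sub_apply, ← hFx u,
        -- Skewness takes R off the field K(e_j, e_k), so that only curvatures of basis vectors
        -- remain.
        hD.inner_curvatureAux_skew (hF w) (hF v) (S.contMDiff_K (hF j) (hF k)) (hF u)]
      simp only [hcurv, hFx]
      rw [inner_eq_sum he (S.K x (e j) (e k)), hlin,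
        S.symm x (e j) (curvature D hD.smooth x (e k) (e w) (e v)), hlin,
        ← Finset.sum_neg_distrib, ← Finset.sum_neg_distrib, ← Finset.sum_sub_distrib,
        ← Finset.sum_sub_distrib]
      refine Finset.sum_congr rfl fun m _ ↦ ?_
      rw [S.symm x (e m) (e j)]
      ring)
    (fun i j k l ↦ by
      rw [Finset.sum_sub_distrib, ← inner_eq_sum he, ← inner_eq_sum he, hK.inner_K_K]
      simp only [he])
    (fun l i j ↦ by
      -- Both derivatives go along e_l, with A = B = e_i and C = U = e_j, so that summation over i
      -- and j makes the left side a product of traces.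
      have h := hK.inner_hessK_K hD (hF l) (hF i) (hF i) (hF j) (hF j) (F l) x
      simp only [hFx] at h
      rw [inner_eq_sum he (S.hessK D x (F l) (F l) (F i) (F i)),
        inner_eq_sum he (S.hessK D x (F l) (F l) (F i) (F j)),
        inner_eq_sum he (S.nablaK D x (e l) (e i) (e i)),
        inner_eq_sum he (S.nablaK D x (e l) (e i) (e j)), inner_eq_sum he (S.K x (e i) (e i)),
        inner_eq_sum he (S.K x (e i) (e j))] at h
      simp only [← Finset.sum_add_distrib] at h
      convert h using 2 <;> ring)
  have hric : ∑ j, ∑ k, ricci D hD.smooth x (S.K x (e j) (e k)) (S.K x (e j) (e k))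
      = ∑ j, ∑ k, ∑ i, ∑ m,
        (∑ l, S.g.inner x (curvature D hD.smooth x (e m) (e l) (e i)) (e l))
          * S.g.inner x (S.K x (e i) (e j)) (e k) * S.g.inner x (S.K x (e m) (e j)) (e k) := by
    refine Finset.sum_congr rfl fun j _ ↦ Finset.sum_congr rfl fun k _ ↦ ?_
    have hcyc : ∀ i, S.g.inner x (S.K x (e i) (e j)) (e k)
        = S.g.inner x (S.K x (e j) (e k)) (e i) := by
      intro i
      rw [S.symm x (e i), S.symm_g, S.g.symm]
    conv_lhs => rw [← sum_inner_smul he (S.K x (e j) (e k)), ricci_sum_smul hD he]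
    simp only [ricci_eq_sum hD he, hcyc]
  have hscal : ∑ i, ricci D hD.smooth x (e i) (e i)
      = ∑ i, ∑ l, S.g.inner x (curvature D hD.smooth x (e i) (e l) (e i)) (e l) :=
    Finset.sum_congr rfl fun i _ ↦ ricci_eq_sum hD he _ _
  rw [hric, hscal]
  exact b

end StatisticalStructure

end

end StatGeom

/-! ### Vanishing from the Bochner formula -/

theorem theorem4p17 {n : ℕ} {M : Type*} [TopologicalSpace M] [T2Space M]
    [ChartedSpace (EuclideanSpace ℝ (Fin n)) M] [IsManifold (𝓡 n) ∞ M]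
    (S : StatGeom.StatisticalStructure (𝓡 n) M)
    (D : CovariantDerivative (𝓡 n) (EuclideanSpace ℝ (Fin n)) (TangentSpace (𝓡 n) : M → Type _))
    (hD : StatGeom.IsLeviCivita S.g D)
    (hconj : S.IsConjugateSymmetric D)
    (htau : ∀ (x : M) (u v : TangentSpace (𝓡 n) x), S.nablaTau D x u v = 0)
    (hric : ∀ (x : M) (v : TangentSpace (𝓡 n) x), 0 ≤ StatGeom.ricci D hD.smooth x v v)
    (κ : ℝ) (hκ : κ ≤ 0) (hK : S.HasConstantSectionalKCurvature κ) :
    (∀ (x : M) (u v w : TangentSpace (𝓡 n) x), S.nablaK D x u v w = 0) ∧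
      (κ < 0 → ∀ (x : M) (v w : TangentSpace (𝓡 n) x), StatGeom.ricci D hD.smooth x v w = 0) := by
  have main : ∀ x : M, (∀ u v w : TangentSpace (𝓡 n) x, S.nablaK D x u v w = 0) ∧
      (κ < 0 → ∀ v w : TangentSpace (𝓡 n) x, StatGeom.ricci D hD.smooth x v w = 0) := by
    intro x
    obtain ⟨m, e, he⟩ := StatGeom.exists_orthonormal_basis S.g x
    have h := StatGeom.StatisticalStructure.bochner_formula hD hconj htau hK he
    have h1 : 0 ≤ ∑ j, ∑ k, StatGeom.ricci D hD.smooth x (S.K x (e j) (e k)) (S.K x (e j) (e k)) :=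
      Finset.sum_nonneg fun j _ ↦ Finset.sum_nonneg fun k _ ↦ hric x _
    have h2 : 0 ≤ ∑ i, StatGeom.ricci D hD.smooth x (e i) (e i) :=
      Finset.sum_nonneg fun i _ ↦ hric x _
    have h3 : 0 ≤ ∑ l, ∑ i, ∑ j, ∑ k, S.g.inner x (S.nablaK D x (e l) (e i) (e j)) (e k) ^ 2 :=
      Finset.sum_nonneg fun l _ ↦ Finset.sum_nonneg fun i _ ↦ Finset.sum_nonneg fun j _ ↦
        Finset.sum_nonneg fun k _ ↦ sq_nonneg _
    have h4 := mul_nonneg (neg_nonneg.2 hκ) h2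
    refine ⟨?_, fun hκ' ↦ StatGeom.ricci_eq_zero_of_sum_eq_zero hD he (hric x) ?_⟩
    -- The Bochner formula writes zero as a sum of the nonnegative quantities `h1`, `h3` and twice
    -- `h4`.
    · have h5 : ∑ l, ∑ i, ∑ j, ∑ k, S.g.inner x (S.nablaK D x (e l) (e i) (e j)) (e k) ^ 2 = 0 := by
        linarith
      have h6 : ∀ l i j, S.nablaK D x (e l) (e i) (e j) = 0 := by
        intro l i j
        rw [← StatGeom.sum_inner_smul he (S.nablaK D x (e l) (e i) (e j))]
        refine Finset.sum_eq_zero fun k _ ↦ ?_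
        rw [Finset.sum_eq_zero_iff_of_nonneg fun l _ ↦ Finset.sum_nonneg fun i _ ↦
          Finset.sum_nonneg fun j _ ↦ Finset.sum_nonneg fun k _ ↦ sq_nonneg _] at h5
        have h7 := h5 l (Finset.mem_univ l)
        rw [Finset.sum_eq_zero_iff_of_nonneg fun i _ ↦
          Finset.sum_nonneg fun j _ ↦ Finset.sum_nonneg fun k _ ↦ sq_nonneg _] at h7
        have h8 := h7 i (Finset.mem_univ i)
        rw [Finset.sum_eq_zero_iff_of_nonneg fun j _ ↦
          Finset.sum_nonneg fun k _ ↦ sq_nonneg _] at h8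
        have h9 := h8 j (Finset.mem_univ j)
        rw [Finset.sum_eq_zero_iff_of_nonneg fun k _ ↦ sq_nonneg _] at h9
        rw [pow_eq_zero_iff two_ne_zero |>.1 (h9 k (Finset.mem_univ k)), zero_smul]
      have h7 : ∀ l v w, S.nablaK D x (e l) v w = 0 := by
        intro l v w
        rw [← e.sum_repr v, ← e.sum_repr w]
        simp only [map_sum, map_smul, sum_apply, smul_apply, h6, smul_zero, Finset.sum_const_zero]
      intro u v w
      rw [← e.sum_repr v, map_sum, sum_apply]
      refine Finset.sum_eq_zero fun i _ ↦ ?_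
      -- `nablaK` is not bundled as linear in its direction u; conjugate symmetry exchanges u with a
      -- basis vector, where `h7` applies.
      rw [map_smul, smul_apply, (hconj x u (e i) w).1, h7, smul_zero]
    · have h5 : κ * ∑ i, StatGeom.ricci D hD.smooth x (e i) (e i) = 0 := by linarith
      exact (mul_eq_zero.1 h5).resolve_left hκ'.ne
  exact ⟨fun x ↦ (main x).1, fun hκ' x ↦ (main x).2 hκ'⟩
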